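/- Let $d\ge 0$ be an integer and let $A=\bigoplus_{i=-d}^{d}A^i$ be a graded Frobenius algebra of degree $d$ over $\mathbb Q$: a finite dimensional graded vector space with an associative, graded commutative multiplication of degree $d$ (so $A^iA^j\subseteq A^{i+j+d}$ and $ab=(-1)^{|a||b|}ba$), a unit $1\in A^{-d}$, and a linear form $\int:A\to\mathbb Q$ of degree $-d$ (it vanishes on $A^i$ for $i\neq d$) such that the form $\langle a,b\rangle=\int ab$ is non-degenerate. For a finite set $I$ let $A^{\otimes I}$ be the tensor product of copies of $A$ indexed by the unordered set $I$: the algebra generated by copies of $A$, one for each $i\in I$, in which homogeneous elements of different copies commute up to the sign $(-1)^{|a||b|}$. Every enumeration of $I$ identifies it with the graded tensor product $A^{\otimes |I|}$ with its Koszul-signed product. A pure tensor of homogeneous elements has as degree the sum of their degrees, and $\int$ on $A^{\otimes I}$ is the product of the integrals of the factors. A surjection $\varphi:I\to J$ of finite sets induces the ring homomorphism $\varphi^*:A^{\otimes I}\to A^{\otimes J}$ that multiplies the factors in each fibre, and $\varphi_*:A^{\otimes J}\to A^{\otimes I}$ denotes its adjoint, $\langle\varphi_*(w),v\rangle=\langle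 w,\varphi^*(v)\rangle$. Let $e\in A$ be the Euler class, i.e. the image of $1$ under $A\xrightarrow{\Delta_*}A\otimes A\to A$, where the second map is the multiplication and $\Delta_*$ is its adjoint. For $\nu:I\to\mathbb N_0$ put $e^\nu=\bigotimes_{i\in I}e^{\nu(i)}\in A^{\otimes I}$. Let $n\ge 0$ and $[n]=\{1,\dots,n\}$. For $\pi,\rho\in S_n$ and an orbit $B\in\langle\pi,\rho\rangle\backslash[n]$ let $$g(\pi,\rho)(B)=\tfrac12\bigl(|B|+2-|\langle\pi\rangle\backslash B|-|\langle\rho\rangle\backslash B|-|\langle\pi\rho\rangle\backslash B|\bigr)$$ be the graph defect. For subgroups $H\subseteq K$ of $S_n$ let $f^{H,K}:A^{\otimes H\backslash[n]}\to A^{\otimes K\backslash[n]}$ and $f_{K,H}:A^{\otimes K\backslash[n]}\to A^{\otimes H\backslash[n]}$ be $\varphi^*$ and $\varphi_*$ for the canonical surjection $\varphi:H\backslash[n]\to K\backslash[n]$. Let $A\{S_n\}=\bigoplus_{\pi\in S_n}A^{\otimes\langle\pi\rangle\backslash[n]}\cdot\pi$, graded by $|a\pi|=|a|$, and let $\sigma\in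 S_n$ act on it by $\tilde\sigma(a\pi)=\sigma^*(a)\,\sigma\pi\sigma^{-1}$, where $\sigma$ also denotes the bijection $\langle\pi\rangle\backslash[n]\to\langle\sigma\pi\sigma^{-1}\rangle\backslash[n]$, $x\mapsto\sigma x$. Define a bilinear product on $A\{S_n\}$ by $$a\pi\cdot b\rho=m_{\pi,\rho}(a\otimes b)\,\pi\rho,\qquad m_{\pi,\rho}(a\otimes b)=f_{\langle\pi,\rho\rangle,\langle\pi\rho\rangle}\bigl(f^{\langle\pi\rangle,\langle\pi,\rho\rangle}(a)\cdot f^{\langle\rho\rangle,\langle\pi,\rho\rangle}(b)\cdot e^{g(\pi,\rho)}\bigr).$$ Then the graph defect $g(\pi,\rho)$ takes values in the non-negative integers for all $\pi,\rho\in S_n$ (so that $e^{g(\pi,\rho)}$ makes sense), and the product on $A\{S_n\}$ is 1. associative; 2. $S_n$-equivariant: $\tilde\sigma(x\cdot y)=\tilde\sigma(x)\cdot\tilde\sigma(y)$ for all $\sigma\in S_n$ and $x,y\in A\{S_n\}$; 3. homogeneous of degree $nd$: if $x$ and $y$ are homogeneous of degrees $p$ and $q$, then $x\cdot y$ is homogeneous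 of degree $p+q+nd$. -/

import Mathlib

/-- A graded Frobenius algebra of degree `d` over `ℚ`, on the `ℚ`-algebra `A`: a grading
`A = ⨁_{i = -d}^{d} A^i` of the finite dimensional space `A`, such that the product is
homogeneous of degree `d` and graded commutative, the unit has degree `-d`, together with a
linear form of degree `-d` (it vanishes off `A^d`) whose form `⟨a, b⟩ = ∫ a b` is
non-degenerate. -/
structure GradedFrobenius (A : Type*) [Ring A] [Algebra ℚ A] (d : ℕ) where
  gr : ℤ → Submodule ℚ A
  isInternal : DirectSum.IsInternal gr
  finite : Module.Finite ℚ A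
  gr_eq_bot : ∀ i : ℤ, i < -(d : ℤ) ∨ (d : ℤ) < i → gr i = ⊥
  one_mem : (1 : A) ∈ gr (-(d : ℤ))
  mul_mem : ∀ {i j : ℤ} {a b : A}, a ∈ gr i → b ∈ gr j → a * b ∈ gr (i + j + d)
  graded_comm : ∀ {i j : ℤ} {a b : A}, a ∈ gr i → b ∈ gr j →
    a * b = ((-1 : ℚ) ^ (i * j)) • (b * a)
  integral : A →ₗ[ℚ] ℚ
  integral_eq_zero : ∀ {i : ℤ} {a : A}, a ∈ gr i → i ≠ d → integral a = 0
  nondegenerate : ∀ a : A, (∀ b : A, integral (a * b) = 0) → a = 0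

namespace GradedFrobenius

noncomputable section

variable {A : Type*} [Ring A] [Algebra ℚ A] {d : ℕ} (F : GradedFrobenius A d)

/-! ### The tensor product `A^{⊗I}` over an unordered index set -/

/-- Relations between the symbols `(i, a)`, standing for `a` placed in the factor `i`. -/
inductive TensorRel (I : Type*) : FreeAlgebra ℚ (I × A) → FreeAlgebra ℚ (I × A) → Prop
  | add (i : I) (a b : A) : TensorRel I (FreeAlgebra.ι ℚ (i, a + b))
      (FreeAlgebra.ι ℚ (i, a) + FreeAlgebra.ι ℚ (i, b))
  | smul (i : I) (c : ℚ) (a : A) : TensorRel I (FreeAlgebra.ι ℚ (i, c • a))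
      (c • FreeAlgebra.ι ℚ (i, a))
  | one (i : I) : TensorRel I (FreeAlgebra.ι ℚ (i, 1)) 1
  | mul (i : I) (a b : A) : TensorRel I (FreeAlgebra.ι ℚ (i, a * b))
      (FreeAlgebra.ι ℚ (i, a) * FreeAlgebra.ι ℚ (i, b))
  | comm (i j : I) (hij : i ≠ j) (p q : ℤ) (a b : A) (ha : a ∈ F.gr p) (hb : b ∈ F.gr q) :
      TensorRel I (FreeAlgebra.ι ℚ (i, a) * FreeAlgebra.ι ℚ (j, b))
        (((-1 : ℚ) ^ (p * q)) • (FreeAlgebra.ι ℚ (j, b) * FreeAlgebra.ι ℚ (i, a)))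

/-- The algebra `A^{⊗I}`, for an unordered finite set `I`: it is generated by copies of the
algebra `A`, one for each `i ∈ I`, and homogeneous elements of different copies commute up to
the usual sign. See `tensorEquiv` for the canonical isomorphism with `A ⊗ ⋯ ⊗ A` that belongs to
an enumeration of `I`. -/
def Tensor (I : Type*) : Type _ := RingQuot (F.TensorRel I)

instance (I : Type*) : Ring (F.Tensor I) := inferInstanceAs (Ring (RingQuot (F.TensorRel I)))

instance (I : Type*) : Algebra ℚ (F.Tensor I) :=
  inferInstanceAs (Algebra ℚ (RingQuot (F.TensorRel I)))

variable {I J : Type*}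

/-- The quotient map from the free algebra. -/
def quot (I : Type*) : FreeAlgebra ℚ (I × A) →ₐ[ℚ] F.Tensor I :=
  RingQuot.mkAlgHom ℚ (F.TensorRel I)

theorem quot_rel {x y : FreeAlgebra ℚ (I × A)} (h : F.TensorRel I x y) : F.quot I x = F.quot I y :=
  RingQuot.mkAlgHom_rel ℚ h

/-- The inclusion of `A` as the `i`-th tensor factor. -/
def incl (i : I) : A →ₐ[ℚ] F.Tensor I :=
  AlgHom.ofLinearMap
    { toFun := fun a => F.quot I (FreeAlgebra.ι ℚ (i, a))
      map_add' := fun a b => by rw [F.quot_rel (TensorRel.add i a b), map_add]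
      map_smul' := fun c a => by
        rw [F.quot_rel (TensorRel.smul i c a), map_smul, RingHom.id_apply] }
    (by
      change F.quot I (FreeAlgebra.ι ℚ (i, 1)) = 1
      rw [F.quot_rel (TensorRel.one i), map_one])
    (fun a b => by
      change F.quot I (FreeAlgebra.ι ℚ (i, a * b)) = F.quot I (FreeAlgebra.ι ℚ (i, a)) *
        F.quot I (FreeAlgebra.ι ℚ (i, b))
      rw [F.quot_rel (TensorRel.mul i a b), map_mul])

theorem quot_ι (i : I) (a : A) : F.quot I (FreeAlgebra.ι ℚ (i, a)) = F.incl i a := rfl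

theorem incl_mul_incl {i j : I} (hij : i ≠ j) {p q : ℤ} {a b : A} (ha : a ∈ F.gr p)
    (hb : b ∈ F.gr q) :
    F.incl i a * F.incl j b = ((-1 : ℚ) ^ (p * q)) • (F.incl j b * F.incl i a) := by
  have := F.quot_rel (TensorRel.comm i j hij p q a b ha hb)
  rwa [map_mul, map_smul, map_mul] at this

/-- The universal property of `A^{⊗I}`. -/
def liftHom {B : Type*} [Ring B] [Algebra ℚ B] (f : I → A →ₐ[ℚ] B)
    (hf : ∀ (i j : I), i ≠ j → ∀ (p q : ℤ) (a b : A), a ∈ F.gr p → b ∈ F.gr q →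
      f i a * f j b = ((-1 : ℚ) ^ (p * q)) • (f j b * f i a)) : F.Tensor I →ₐ[ℚ] B :=
  RingQuot.liftAlgHom ℚ ⟨FreeAlgebra.lift ℚ fun x => f x.1 x.2, by
    rintro x y (⟨i, a, b⟩ | ⟨i, c, a⟩ | ⟨i⟩ | ⟨i, a, b⟩ | ⟨i, j, hij, p, q, a, b, ha, hb⟩)
    · simp
    · simp
    · simp
    · simp
    · simpa using hf i j hij p q a b ha hb⟩

@[simp]
theorem liftHom_incl {B : Type*} [Ring B] [Algebra ℚ B] (f : I → A →ₐ[ℚ] B)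
    (hf : ∀ (i j : I), i ≠ j → ∀ (p q : ℤ) (a b : A), a ∈ F.gr p → b ∈ F.gr q →
      f i a * f j b = ((-1 : ℚ) ^ (p * q)) • (f j b * f i a)) (i : I) (a : A) :
    F.liftHom f hf (F.incl i a) = f i a := by
  change RingQuot.liftAlgHom ℚ _ (RingQuot.mkAlgHom ℚ (F.TensorRel I) _) = _
  rw [RingQuot.liftAlgHom_mkAlgHom_apply, FreeAlgebra.lift_ι_apply]

/-- The ring homomorphism `φ^* : A^{⊗I} → A^{⊗J}` of a map `φ : I → J`: it multiplies the
factors in each fibre of `φ`. -/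
def pull (φ : I → J) : F.Tensor I →ₐ[ℚ] F.Tensor J :=
  F.liftHom (fun i => F.incl (φ i)) (by
    intro i j _ p q a b ha hb
    by_cases h : φ i = φ j
    · rw [h, ← map_mul, ← map_mul, F.graded_comm ha hb, map_smul]
    · exact F.incl_mul_incl h ha hb)

/-- The multiplication `A^{⊗I} → A` of all tensor factors. -/
def mulAll (I : Type*) : F.Tensor I →ₐ[ℚ] A :=
  F.liftHom (fun _ => AlgHom.id ℚ A) (fun _ _ _ _ _ _ _ ha hb => F.graded_comm ha hb)

/-- The pure tensor `a_{l₁} ⊗ ⋯ ⊗ a_{lₙ}`, where `l₁, …, lₙ` is an enumeration of `I`. -/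
def pure (l : List I) (a : I → A) : F.Tensor I := (l.map fun i => F.incl i (a i)).prod

/-- The part of degree `m` of `A^{⊗I}`: it is spanned by the pure tensors of homogeneous elements
whose degrees add up to `m`. -/
def tensorGr (I : Type*) (m : ℤ) : Submodule ℚ (F.Tensor I) :=
  Submodule.span ℚ {x | ∃ (l : List I) (k : I → ℤ) (a : I → A), l.Nodup ∧ (∀ i, i ∈ l) ∧
    (∀ i, a i ∈ F.gr (k i)) ∧ (l.map k).sum = m ∧ x = F.pure l a}

/-! ### The underlying vector space of `A^{⊗I}` -/

variable {F} in
theorem hom_induction {P : A → Prop} (h : ∀ k, ∀ a ∈ F.gr k, P a)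
    (hadd : ∀ a b, P a → P b → P (a + b)) (a : A) : P a := by
  have ha : a ∈ iSup F.gr := by rw [F.isInternal.submodule_iSup_eq_top]; trivial
  exact Submodule.iSup_induction F.gr (motive := P) ha h (h 0 0 (zero_mem _)) hadd

/-- A linear map given on the homogeneous parts. -/
def gradedLift {B : Type*} [AddCommGroup B] [Module ℚ B] (f : ℤ → A →ₗ[ℚ] B) : A →ₗ[ℚ] B :=
  (DirectSum.toModule ℚ ℤ B fun k => f k ∘ₗ (F.gr k).subtype) ∘ₗ
    (LinearEquiv.ofBijective (DirectSum.coeLinearMap F.gr) F.isInternal).symm.toLinearMap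

theorem gradedLift_apply {B : Type*} [AddCommGroup B] [Module ℚ B] (f : ℤ → A →ₗ[ℚ] B)
    {k : ℤ} {a : A} (ha : a ∈ F.gr k) : F.gradedLift f a = f k a := by
  have : (LinearEquiv.ofBijective (DirectSum.coeLinearMap F.gr) F.isInternal).symm a =
      DirectSum.lof ℚ ℤ (fun i => F.gr i) k ⟨a, ha⟩ := by
    rw [LinearEquiv.symm_apply_eq]
    exact (DirectSum.coeLinearMap_lof F.gr k ⟨a, ha⟩).symm
  simp only [gradedLift, LinearMap.comp_apply, LinearEquiv.coe_coe, this,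
    DirectSum.toModule_lof, Submodule.subtype_apply]

theorem even_or (F : GradedFrobenius A d) : Even (d : ℤ) ∨ Subsingleton A := by
  rcases Int.even_or_odd (d : ℤ) with h | h
  · exact Or.inl h
  · right
    have h1 := F.graded_comm F.one_mem F.one_mem
    rw [(h.neg.mul h.neg).neg_one_zpow] at h1
    have h3 : (1 : A) = 0 := by
      have h2 : (2 : ℚ) • (1 : A) = 0 := by
        rw [two_smul]; nth_rewrite 1 [← one_mul (1 : A)]; rw [h1]; simp
      simpa using h2
    exact subsingleton_of_zero_eq_one h3.symm

/-- The operator `a ↦ (-1)^{k |a|} a`. -/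
def signOp (k : ℤ) : A →ₗ[ℚ] A := F.gradedLift fun m => ((-1 : ℚ) ^ (k * m)) • LinearMap.id

theorem signOp_apply (k : ℤ) {m : ℤ} {a : A} (ha : a ∈ F.gr m) :
    F.signOp k a = ((-1 : ℚ) ^ (k * m)) • a := by
  rw [signOp, F.gradedLift_apply _ ha]; rfl

theorem signOp_mem (k : ℤ) {m : ℤ} {a : A} (ha : a ∈ F.gr m) : F.signOp k a ∈ F.gr m := by
  rw [F.signOp_apply k ha]; exact Submodule.smul_mem _ _ ha

theorem signOp_one (k : ℤ) : F.signOp k 1 = 1 := by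
  rcases F.even_or with h | h
  · rw [F.signOp_apply k F.one_mem, (h.neg.mul_left k).neg_one_zpow, one_smul]
  · exact Subsingleton.elim _ _

theorem signOp_comp (k l : ℤ) (a : A) : F.signOp k (F.signOp l a) = F.signOp (k + l + d) a := by
  rcases F.even_or with h | h
  · induction a using F.hom_induction with
    | h m a ha =>
      rw [F.signOp_apply l ha, map_smul, F.signOp_apply k ha, F.signOp_apply _ ha, smul_smul,
        add_mul, add_mul, zpow_add₀ (by norm_num), zpow_add₀ (by norm_num),
        (h.mul_right m).neg_one_zpow, mul_one, mul_comm]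
    | hadd a b ha hb => simp only [map_add, ha, hb]
  · exact Subsingleton.elim _ _

theorem signOp_comm (k l : ℤ) (a : A) :
    F.signOp k (F.signOp l a) = F.signOp l (F.signOp k a) := by
  rw [signOp_comp, signOp_comp, add_comm k l]

theorem signOp_mul (l : ℤ) {k : ℤ} {a : A} (ha : a ∈ F.gr k) (b : A) :
    F.signOp l (a * b) = ((-1 : ℚ) ^ (l * k)) • (a * F.signOp l b) := by
  rcases F.even_or with h | h
  · induction b using F.hom_induction with
    | h m b hb =>
      rw [F.signOp_apply l hb, F.signOp_apply l (F.mul_mem ha hb), mul_smul_comm, smul_smul,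
        mul_add, mul_add, zpow_add₀ (by norm_num), zpow_add₀ (by norm_num),
        (h.mul_left l).neg_one_zpow, mul_one]
    | hadd b c hb hc => simp only [map_add, mul_add, hb, hc, smul_add]
  · exact Subsingleton.elim _ _

open PiTensorProduct TensorProduct

variable {n : ℕ} (f : Fin n ≃ I)

open scoped Classical in
/-- The family of operators by which a homogeneous element `a` of degree `k`, in the factor `i`,
acts on pure tensors: the factors before `i` get a sign and the factor `i` is multiplied. -/
def actFam (i : I) (k : ℤ) (a : A) : I → A →ₗ[ℚ] A :=
  Function.update (fun j => if f.symm j < f.symm i then F.signOp k else LinearMap.id) i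
    (LinearMap.mulLeft ℚ a)

theorem actFam_self (i : I) (k : ℤ) (a : A) : F.actFam f i k a i = LinearMap.mulLeft ℚ a := by
  simp [actFam]

theorem actFam_lt {i j : I} (h : f.symm j < f.symm i) (k : ℤ) (a : A) :
    F.actFam f i k a j = F.signOp k := by
  have : j ≠ i := by rintro rfl; exact lt_irrefl _ h
  simp [actFam, this, h]

theorem actFam_gt {i j : I} (h : f.symm i < f.symm j) (k : ℤ) (a : A) :
    F.actFam f i k a j = LinearMap.id := by
  have : j ≠ i := by rintro rfl; exact lt_irrefl _ h
  simp [actFam, this, not_lt.2 h.le]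

open scoped Classical in
/-- The action of the factor `i` on `A ⊗ ⋯ ⊗ A`. -/
def act (i : I) : A →ₗ[ℚ] Module.End ℚ (⨂[ℚ] _ : I, A) :=
  F.gradedLift fun k =>
    (PiTensorProduct.mapMultilinear ℚ (fun _ : I => A) (fun _ : I => A)).toLinearMap
      (fun j => if f.symm j < f.symm i then F.signOp k else LinearMap.id) i ∘ₗ LinearMap.mul ℚ A

theorem act_apply (i : I) {k : ℤ} {a : A} (ha : a ∈ F.gr k) :
    F.act f i a = PiTensorProduct.map (F.actFam f i k a) := by
  rw [act, F.gradedLift_apply _ ha]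
  rfl

theorem act_one (i : I) : F.act f i 1 = 1 := by
  rcases F.even_or with h | h
  · rw [F.act_apply f i F.one_mem, ← PiTensorProduct.map_one]
    congr 1
    funext j
    rcases lt_trichotomy (f.symm j) (f.symm i) with h' | h' | h'
    · rw [F.actFam_lt f h']
      ext a
      induction a using F.hom_induction with
      | h m a ha => rw [F.signOp_apply _ ha, (h.neg.mul_right m).neg_one_zpow, one_smul]; rfl
      | hadd a b ha hb => rw [map_add, map_add, ha, hb]
    · obtain rfl := f.symm.injective h'
      rw [F.actFam_self]; ext; simp
    · rw [F.actFam_gt f h']; rfl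
  · ext a
    have : a = 0 ∨ IsEmpty I := by
      left; exact Subsingleton.elim _ _
    simp only [LinearMap.compMultilinearMap_apply, F.act_apply f i F.one_mem]
    rw [PiTensorProduct.map_tprod]
    exact congrArg _ (Subsingleton.elim _ _)

theorem act_mul (i : I) (a b : A) : F.act f i (a * b) = F.act f i a * F.act f i b := by
  induction a using F.hom_induction with
  | hadd a a' ha ha' => rw [add_mul, map_add, map_add, add_mul, ha, ha']
  | h k a ha =>
    induction b using F.hom_induction with
    | hadd b b' hb hb' => rw [mul_add, map_add, map_add, mul_add, hb, hb']
    | h l b hb =>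
      rw [F.act_apply f i ha, F.act_apply f i hb, F.act_apply f i (F.mul_mem ha hb),
        ← PiTensorProduct.map_mul]
      congr 1
      funext j
      rcases lt_trichotomy (f.symm j) (f.symm i) with h' | h' | h'
      · rw [F.actFam_lt f h', F.actFam_lt f h', F.actFam_lt f h']
        ext x
        exact (F.signOp_comp k l x).symm
      · obtain rfl := f.symm.injective h'
        simp only [F.actFam_self]; ext x; simp
      · simp only [F.actFam_gt f h']; rfl

/-- `act` as an algebra homomorphism. -/
def actHom (i : I) : A →ₐ[ℚ] Module.End ℚ (⨂[ℚ] _ : I, A) :=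
  AlgHom.ofLinearMap (F.act f i) (F.act_one f i) (F.act_mul f i)

theorem act_comm_of_lt {i j : I} (hij : f.symm i < f.symm j) {p q : ℤ} {a b : A}
    (ha : a ∈ F.gr p) (hb : b ∈ F.gr q) :
    F.act f j b * F.act f i a = ((-1 : ℚ) ^ (p * q)) • (F.act f i a * F.act f j b) := by
  classical
  rw [F.act_apply f i ha, F.act_apply f j hb, ← PiTensorProduct.map_mul,
    ← PiTensorProduct.map_mul]
  have key : (fun m => F.actFam f j q b m * F.actFam f i p a m) =
      Function.update (fun m => F.actFam f i p a m * F.actFam f j q b m) i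
        (((-1 : ℚ) ^ (p * q)) • (F.actFam f i p a i * F.actFam f j q b i)) := by
    funext m
    by_cases hm : m = i
    · subst hm
      rw [Function.update_self, F.actFam_lt f hij, F.actFam_self]
      ext x
      simp [F.signOp_mul q ha, mul_comm p q]
    · rw [Function.update_of_ne hm]
      rcases lt_trichotomy (f.symm m) (f.symm i) with h' | h' | h'
      · rw [F.actFam_lt f h', F.actFam_lt f (h'.trans hij)]
        ext x
        exact F.signOp_comm _ _ _
      · exact absurd (f.symm.injective h') hm
      · rw [F.actFam_gt f h']; rfl
  rw [key]
  have := (PiTensorProduct.mapMultilinear ℚ (fun _ : I => A) (fun _ : I => A)).map_update_smul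
    (fun m => F.actFam f i p a m * F.actFam f j q b m) i ((-1 : ℚ) ^ (p * q))
    (F.actFam f i p a i * F.actFam f j q b i)
  rw [Function.update_eq_self] at this
  exact this

/-- The action of the algebra `A^{⊗I}` on the vector space `A ⊗ ⋯ ⊗ A`, for an enumeration. -/
def rep : F.Tensor I →ₐ[ℚ] Module.End ℚ (⨂[ℚ] _ : I, A) :=
  F.liftHom (F.actHom f) (by
    intro i j hij p q a b ha hb
    change F.act f i a * F.act f j b = _ • (F.act f j b * F.act f i a)
    rcases lt_or_gt_of_ne (fun h => hij (f.symm.injective h)) with h | h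
    · rw [F.act_comm_of_lt f h ha hb, smul_smul, ← mul_zpow]; simp
    · rw [F.act_comm_of_lt f h hb ha, mul_comm q p])

theorem rep_incl (i : I) (a : A) : F.rep f (F.incl i a) = F.act f i a :=
  F.liftHom_incl _ _ _ _

/-- The linear map `A ⊗ ⋯ ⊗ A → A^{⊗I}` of the enumeration `f` of `I`. -/
def ofTensor : (⨂[ℚ] _ : I, A) →ₗ[ℚ] F.Tensor I :=
  PiTensorProduct.lift (((MultilinearMap.mkPiAlgebraFin ℚ n (F.Tensor I)).domDomCongr f).compLinearMap
    fun i => (F.incl i).toLinearMap)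

theorem ofTensor_tprod (a : I → A) :
    F.ofTensor f (PiTensorProduct.tprod ℚ a) = F.pure (List.ofFn f) a := by
  simp [ofTensor, pure, List.map_ofFn, Function.comp_def]

theorem incl_mul_prod {i : I} {l : List I} (hi : i ∉ l) {k : ℤ} {b : A} (hb : b ∈ F.gr k)
    (a : I → A) :
    F.incl i b * F.pure l a = F.pure l (fun j => F.signOp k (a j)) * F.incl i b := by
  induction l with
  | nil => simp [pure]
  | cons j l ih =>
    have h1 : ∀ x : A, F.incl i b * F.incl j x = F.incl j (F.signOp k x) * F.incl i b := by
      intro x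
      induction x using F.hom_induction with
      | h m x hx =>
        rw [F.incl_mul_incl (by rintro rfl; simp at hi) hb hx, F.signOp_apply k hx, map_smul,
          smul_mul_assoc]
      | hadd x y hx hy => simp only [map_add, mul_add, add_mul, hx, hy]
    have ih := ih (by simp at hi; exact hi.2)
    simp only [pure, List.map_cons, List.prod_cons] at ih ⊢
    rw [← mul_assoc, h1, mul_assoc, ih, mul_assoc]

theorem pure_congr {l : List I} {a b : I → A} (h : ∀ i ∈ l, a i = b i) :
    F.pure l a = F.pure l b := by
  rw [pure, pure]
  exact congrArg List.prod (List.map_congr_left fun i hi => by rw [h i hi])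

theorem exists_split (i : I) : ∃ l₁ l₂ : List I, List.ofFn f = l₁ ++ i :: l₂ ∧
    (∀ j ∈ l₁, f.symm j < f.symm i) ∧ (∀ j ∈ l₂, f.symm i < f.symm j) := by
  obtain ⟨l₁, l₂, h⟩ := List.append_of_mem (show i ∈ List.ofFn f from
    (List.mem_ofFn' _ _).2 ⟨f.symm i, by simp⟩)
  have hp : (List.ofFn f).Pairwise fun a b => f.symm a < f.symm b := by
    rw [List.pairwise_ofFn]
    intro a b hab
    simpa using hab
  rw [h, List.pairwise_append] at hp
  refine ⟨l₁, l₂, h, fun j hj => hp.2.2 j hj i (by simp), fun j hj => ?_⟩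
  exact (List.pairwise_cons.1 hp.2.1).1 j hj

theorem ofTensor_act (i : I) (b : A) (v : ⨂[ℚ] _ : I, A) :
    F.ofTensor f (F.act f i b v) = F.incl i b * F.ofTensor f v := by
  induction b using F.hom_induction with
  | hadd b c hb hc => simp only [map_add, LinearMap.add_apply, hb, hc, add_mul]
  | h k b hb =>
    induction v using PiTensorProduct.induction_on with
    | add v w hv hw => simp only [map_add, hv, hw, mul_add]
    | smul_tprod r a =>
      rw [map_smul, map_smul, map_smul, mul_smul_comm, F.act_apply f i hb,
        PiTensorProduct.map_tprod, F.ofTensor_tprod, F.ofTensor_tprod]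
      congr 1
      obtain ⟨l₁, l₂, h, h₁, h₂⟩ := exists_split f i
      have e : ∀ a : I → A, F.pure (List.ofFn f) a =
          F.pure l₁ a * (F.incl i (a i) * F.pure l₂ a) := by
        intro a; rw [h]; simp [pure]
      rw [e, e, ← mul_assoc (F.incl i b), F.incl_mul_prod (fun hi => lt_irrefl _ (h₁ i hi)) hb]
      rw [F.pure_congr (a := fun j => F.actFam f i k b j (a j)) (b := fun j => F.signOp k (a j))
          (fun j hj => by rw [F.actFam_lt f (h₁ j hj)]),
        F.pure_congr (l := l₂) (a := fun j => F.actFam f i k b j (a j)) (b := a)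
          (fun j hj => by rw [F.actFam_gt f (h₂ j hj)]; rfl), F.actFam_self]
      simp [mul_assoc]

theorem tensor_induction {P : F.Tensor I → Prop} (hone : P 1)
    (hmul : ∀ i a x, P x → P (F.incl i a * x)) (hadd : ∀ x y, P x → P y → P (x + y))
    (hsmul : ∀ (c : ℚ) x, P x → P (c • x)) (x : F.Tensor I) : P x := by
  obtain ⟨y, rfl⟩ := RingQuot.mkAlgHom_surjective ℚ (F.TensorRel I) x
  suffices ∀ z, P z → P (F.quot I y * z) by
    have h1 := this 1 hone
    rwa [mul_one] at h1
  induction y using FreeAlgebra.induction with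
  | grade0 r =>
    intro z hz
    rw [AlgHom.commutes, ← Algebra.smul_def]
    exact hsmul r z hz
  | grade1 x => intro z hz; exact hmul x.1 x.2 z hz
  | mul y y' h h' => intro z hz; rw [map_mul, mul_assoc]; exact h _ (h' z hz)
  | add y y' h h' => intro z hz; rw [map_add, add_mul]; exact hadd _ _ (h z hz) (h' z hz)

theorem ofTensor_one : F.ofTensor f (PiTensorProduct.tprod ℚ fun _ => 1) = 1 := by
  rw [F.ofTensor_tprod, pure]
  simp only [map_one]
  exact List.prod_eq_one (by simp)

theorem ofTensor_rep (x : F.Tensor I) (v : ⨂[ℚ] _ : I, A) :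
    F.ofTensor f (F.rep f x v) = x * F.ofTensor f v := by
  refine F.tensor_induction (P := fun x => F.ofTensor f (F.rep f x v) = x * F.ofTensor f v)
    (by simp) (fun i a x hx => ?_) (fun x y hx hy => ?_) (fun c x hx => ?_) x
  · rw [map_mul, Module.End.mul_apply, F.rep_incl, F.ofTensor_act, hx, mul_assoc]
  · simp only [map_add, LinearMap.add_apply, hx, hy, add_mul]
  · rw [map_smul, LinearMap.smul_apply, map_smul, hx, smul_mul_assoc]

open scoped Classical in
theorem act_tprod_of_one (i : I) (b : A) (v : I → A) (hv : ∀ j, f.symm j < f.symm i → v j = 1) :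
    F.act f i b (PiTensorProduct.tprod ℚ v) =
      PiTensorProduct.tprod ℚ (Function.update v i (b * v i)) := by
  induction b using F.hom_induction with
  | hadd b c hb hc =>
    rw [map_add, LinearMap.add_apply, hb, hc, add_mul, MultilinearMap.map_update_add]
  | h k b hb =>
    rw [F.act_apply f i hb, PiTensorProduct.map_tprod]
    congr 1
    funext j
    rcases lt_trichotomy (f.symm j) (f.symm i) with h' | h' | h'
    · have : j ≠ i := by rintro rfl; exact lt_irrefl _ h'
      rw [F.actFam_lt f h', Function.update_of_ne this, hv j h', F.signOp_one]
    · obtain rfl := f.symm.injective h'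
      rw [F.actFam_self]; simp
    · have : j ≠ i := by rintro rfl; exact lt_irrefl _ h'
      rw [F.actFam_gt f h', Function.update_of_ne this]; rfl

open scoped Classical in
theorem rep_pure_one (l : List I) (hl : l.Pairwise fun a b => f.symm a < f.symm b) (a : I → A) :
    F.rep f (F.pure l a) (PiTensorProduct.tprod ℚ fun _ => 1) =
      PiTensorProduct.tprod ℚ fun i => if i ∈ l then a i else 1 := by
  induction l with
  | nil => simp [pure]
  | cons i l ih =>
    rw [List.pairwise_cons] at hl
    have : F.pure (i :: l) a = F.incl i (a i) * F.pure l a := by simp [pure]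
    rw [this, map_mul, Module.End.mul_apply, ih hl.2, F.rep_incl, F.act_tprod_of_one]
    · congr 1
      funext j
      by_cases hj : j = i
      · subst hj
        have : j ∉ l := fun h => lt_irrefl _ (hl.1 j h)
        simp [this]
      · simp [hj]
    · intro j hj
      rw [if_neg fun h => lt_asymm hj (hl.1 j h)]

theorem rep_ofTensor_one (v : ⨂[ℚ] _ : I, A) :
    F.rep f (F.ofTensor f v) (PiTensorProduct.tprod ℚ fun _ => 1) = v := by
  induction v using PiTensorProduct.induction_on with
  | add v w hv hw => simp only [map_add, LinearMap.add_apply, hv, hw]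
  | smul_tprod r a =>
    rw [map_smul, map_smul, LinearMap.smul_apply, F.ofTensor_tprod, F.rep_pure_one]
    · congr 2
      funext i
      rw [if_pos ((List.mem_ofFn' _ _).2 ⟨f.symm i, by simp⟩)]
    · rw [List.pairwise_ofFn]
      intro a b hab
      simpa using hab

/-- The canonical isomorphism `A ⊗ ⋯ ⊗ A ≅ A^{⊗I}` of vector spaces that belongs to an
enumeration `f` of `I`; it sends `a` to `a_{f(1)} ⊗ ⋯ ⊗ a_{f(n)}`. -/
def tensorEquiv : (⨂[ℚ] _ : I, A) ≃ₗ[ℚ] F.Tensor I :=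
  LinearEquiv.ofLinearMap (F.ofTensor f)
    ((F.rep f).toLinearMap.flip (PiTensorProduct.tprod ℚ fun _ => 1))
    (by
      ext x
      simp only [LinearMap.comp_apply, LinearMap.flip_apply, AlgHom.toLinearMap_apply,
        F.ofTensor_rep, F.ofTensor_one, mul_one, LinearMap.id_apply])
    (by
      refine LinearMap.ext fun v => ?_
      simp only [LinearMap.comp_apply, LinearMap.flip_apply, AlgHom.toLinearMap_apply,
        F.rep_ofTensor_one, LinearMap.id_apply])

theorem tensorEquiv_tprod (a : I → A) :
    F.tensorEquiv f (PiTensorProduct.tprod ℚ a) = F.pure (List.ofFn f) a :=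
  F.ofTensor_tprod f a

theorem tensorEquiv_symm_apply (x : F.Tensor I) :
    (F.tensorEquiv f).symm x = F.rep f x (PiTensorProduct.tprod ℚ fun _ => 1) := rfl

/-! ### The integral and the bilinear form of `A^{⊗I}` -/

variable (I) in
/-- The linear form `a₁ ⊗ ⋯ ⊗ aₙ ↦ ∫ a₁ ⋯ ∫ aₙ`. -/
def prodIntegral [Finite I] : (⨂[ℚ] _ : I, A) →ₗ[ℚ] ℚ :=
  PiTensorProduct.dualDistrib (PiTensorProduct.tprod ℚ fun _ => F.integral)

theorem prodIntegral_tprod [Fintype I] (a : I → A) :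
    F.prodIntegral I (PiTensorProduct.tprod ℚ a) = ∏ i, F.integral (a i) := by
  simp [prodIntegral]

/-- An enumeration of a finite set. -/
def enum (I : Type*) [Finite I] : Fin (Nat.card I) ≃ I := (Finite.equivFin I).symm

/-- The integral of `A^{⊗I}`, see `tensorIntegral_pure`. -/
def tensorIntegral (I : Type*) [Finite I] : F.Tensor I →ₗ[ℚ] ℚ :=
  F.prodIntegral I ∘ₗ (F.tensorEquiv (enum I)).symm.toLinearMap

theorem pure_perm {k : I → ℤ} {a : I → A} (ha : ∀ i, a i ∈ F.gr (k i)) {l l' : List I}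
    (h : l.Perm l') (hl : l.Nodup) :
    ∃ ε : ℚ, ((∀ i, Even (k i)) → ε = 1) ∧ F.pure l a = ε • F.pure l' a := by
  induction h with
  | nil => exact ⟨1, by simp, by simp⟩
  | cons i _ ih =>
    obtain ⟨ε, h1, h2⟩ := ih (List.nodup_cons.1 hl).2
    refine ⟨ε, h1, ?_⟩
    simp only [pure, List.map_cons, List.prod_cons] at h2 ⊢
    rw [h2, mul_smul_comm]
  | swap i j l =>
    refine ⟨(-1) ^ (k j * k i), fun h => ((h j).mul_right _).neg_one_zpow, ?_⟩
    simp only [pure, List.map_cons, List.prod_cons]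
    rw [← mul_assoc, F.incl_mul_incl (by rintro rfl; simp at hl) (ha j) (ha i), smul_mul_assoc,
      mul_assoc]
  | trans h _ ih ih' =>
    obtain ⟨ε, h1, h2⟩ := ih hl
    obtain ⟨ε', h1', h2'⟩ := ih' (h.nodup_iff.1 hl)
    exact ⟨ε * ε', fun h => by rw [h1 h, h1' h, mul_one], by rw [h2, h2', smul_smul]⟩

variable {F} in
/-- Linear maps on `A ⊗ ⋯ ⊗ A` agree if they agree on tensors of homogeneous elements. -/
theorem homogeneous_ext [Finite I] {B : Type*} [AddCommGroup B] [Module ℚ B]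
    {φ ψ : (⨂[ℚ] _ : I, A) →ₗ[ℚ] B}
    (h : ∀ (k : I → ℤ) (a : I → A), (∀ i, a i ∈ F.gr (k i)) →
      φ (PiTensorProduct.tprod ℚ a) = ψ (PiTensorProduct.tprod ℚ a)) : φ = ψ := by
  refine PiTensorProduct.ext_of_span_eq_top (γ := fun _ => {a : A // ∃ k, a ∈ F.gr k})
    (g := fun _ a => a.1) (fun _ => ?_) fun j => ?_
  · rw [eq_top_iff]
    intro a _
    induction a using F.hom_induction with
    | h k a ha => exact Submodule.subset_span ⟨⟨a, k, ha⟩, rfl⟩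
    | hadd a b ha hb => exact add_mem (ha trivial) (hb trivial)
  · choose k hk using fun i => (j i).2
    exact h k _ hk

theorem tensorIntegral_ofTensor [Finite I] (v : ⨂[ℚ] _ : I, A) :
    F.tensorIntegral I (F.ofTensor f v) = F.prodIntegral I v := by
  have h0 : ∀ w, F.tensorIntegral I (F.ofTensor (enum I) w) = F.prodIntegral I w := fun w => by
    change F.prodIntegral I ((F.tensorEquiv (enum I)).symm (F.tensorEquiv (enum I) w)) = _
    rw [LinearEquiv.symm_apply_apply]
  suffices F.tensorIntegral I ∘ₗ F.ofTensor f = F.prodIntegral I from LinearMap.congr_fun this v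
  refine homogeneous_ext (F := F) fun k a ha => ?_
  have hmem : ∀ {m : ℕ} (g : Fin m ≃ I) (i : I), i ∈ List.ofFn g := fun g i =>
    (List.mem_ofFn' _ _).2 ⟨g.symm i, by simp⟩
  have hnd : ∀ {m : ℕ} (g : Fin m ≃ I), (List.ofFn g).Nodup := fun g =>
    List.nodup_ofFn.2 g.injective
  have hperm : (List.ofFn f).Perm (List.ofFn (enum I)) :=
    (List.perm_ext_iff_of_nodup (hnd f) (hnd _)).2 fun i => by simp only [hmem]
  obtain ⟨ε, h1, h2⟩ := F.pure_perm ha hperm (hnd f)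
  rw [LinearMap.comp_apply, F.ofTensor_tprod, h2, map_smul, ← F.ofTensor_tprod, h0]
  by_cases hk : ∀ i, Even (k i)
  · rw [h1 hk, one_smul]
  · push Not at hk
    obtain ⟨i, hi⟩ := hk
    have hz : F.integral (a i) = 0 := by
      rcases F.even_or with h | h
      · exact F.integral_eq_zero (ha i) fun h' => hi (h' ▸ h)
      · rw [Subsingleton.elim (a i) 0, map_zero]
    have := Fintype.ofFinite I
    rw [F.prodIntegral_tprod, Finset.prod_eq_zero (Finset.mem_univ i) hz, smul_zero]

/-- `∫ a_{l₁} ⊗ ⋯ ⊗ a_{lₙ} = ∫ a_{l₁} ⋯ ∫ a_{lₙ}` for every enumeration `l` of `I`. -/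
theorem tensorIntegral_pure [Fintype I] {l : List I} (hl : l.Nodup) (h : ∀ i, i ∈ l)
    (a : I → A) : F.tensorIntegral I (F.pure l a) = ∏ i, F.integral (a i) := by
  classical
  have := F.tensorIntegral_ofTensor (hl.getEquivOfForallMemList l h) (PiTensorProduct.tprod ℚ a)
  rw [F.ofTensor_tprod, F.prodIntegral_tprod] at this
  rw [← this]
  congr 2
  exact (List.ofFn_get l).symm

/-- The bilinear form `⟨x, y⟩ = ∫ x y` on `A^{⊗I}`. -/
def tensorForm (I : Type*) [Finite I] : LinearMap.BilinForm ℚ (F.Tensor I) :=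
  (LinearMap.mul ℚ (F.Tensor I)).compr₂ (F.tensorIntegral I)

/-- The bilinear form `⟨a, b⟩ = ∫ a b` on `A`. -/
def form : LinearMap.BilinForm ℚ A := (LinearMap.mul ℚ A).compr₂ F.integral

open scoped Classical in
theorem rep_pure_homogeneous {l : List I} (hl : l.Nodup) :
    ∃ ε : (I → ℤ) → (I → ℤ) → ℚ, (∀ p q, ε p q ≠ 0) ∧ ∀ (p q : I → ℤ) (a b : I → A),
      (∀ i, a i ∈ F.gr (p i)) → (∀ i, b i ∈ F.gr (q i)) →
      F.rep f (F.pure l a) (PiTensorProduct.tprod ℚ b) =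
        ε p q • PiTensorProduct.tprod ℚ fun i => if i ∈ l then a i * b i else b i := by
  have : Finite I := Finite.of_equiv _ f
  have := Fintype.ofFinite I
  induction l with
  | nil => exact ⟨fun _ _ => 1, by simp, by simp [pure]⟩
  | cons i l ih =>
    obtain ⟨hil, hl⟩ := List.nodup_cons.1 hl
    obtain ⟨ε, h0, h⟩ := ih hl
    refine ⟨fun p q => ε p q * ∏ j : I, if f.symm j < f.symm i then
      (-1) ^ (p i * if j ∈ l then p j + q j + d else q j) else 1, fun p q => ?_,
      fun p q a b ha hb => ?_⟩
    · refine mul_ne_zero (h0 p q) (Finset.prod_ne_zero_iff.2 fun j _ => ?_)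
      split_ifs
      · exact zpow_ne_zero _ (by norm_num)
      · exact zpow_ne_zero _ (by norm_num)
      · exact one_ne_zero
    · have hp : F.pure (i :: l) a = F.incl i (a i) * F.pure l a := by simp [pure]
      rw [hp, map_mul, Module.End.mul_apply, h p q a b ha hb, map_smul, F.rep_incl,
        F.act_apply f i (ha i), PiTensorProduct.map_tprod, mul_smul,
        ← MultilinearMap.map_smul_univ]
      congr 2
      funext j
      rcases lt_trichotomy (f.symm j) (f.symm i) with h' | h' | h'
      · have hj : j ≠ i := by rintro rfl; exact lt_irrefl _ h'
        rw [F.actFam_lt f h', if_pos h']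
        by_cases hjl : j ∈ l
        · simp only [hjl, if_true, List.mem_cons, or_true]
          exact F.signOp_apply _ (F.mul_mem (ha j) (hb j))
        · simp only [hjl, if_false, List.mem_cons, or_false, hj]
          exact F.signOp_apply _ (hb j)
      · obtain rfl := f.symm.injective h'
        rw [F.actFam_self]
        simp [hil]
      · have hj : j ≠ i := by rintro rfl; exact lt_irrefl _ h'
        rw [F.actFam_gt f h', if_neg (not_lt.2 h'.le)]
        simp [hj]

theorem form_injective : Function.Injective F.form := by
  rw [← LinearMap.ker_eq_bot, LinearMap.ker_eq_bot']
  exact fun a ha => F.nondegenerate a fun b => LinearMap.congr_fun ha b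

theorem prodIntegral_mul_eq_zero [Finite I] (v : ⨂[ℚ] _ : I, A)
    (h : ∀ w, F.prodIntegral I (v * w) = 0) : v = 0 := by
  have := Fintype.ofFinite I
  have := F.finite
  let b := Module.finBasis ℚ A
  let e : A ≃ₗ[ℚ] Module.Dual ℚ A :=
    LinearMap.linearEquivOfInjective F.form F.form_injective Subspace.dual_finrank_eq.symm
  let b' : Module.Basis (Fin (Module.finrank ℚ A)) ℚ A := b.dualBasis.map e.symm
  have hb : ∀ x i, b'.repr x i = F.integral (x * b i) := fun x i => by
    simp only [b', Module.Basis.map_repr, LinearEquiv.trans_apply, LinearEquiv.symm_symm,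
      Module.Basis.dualBasis_repr]
    rfl
  refine (Basis.piTensorProduct fun _ : I => b').ext_elem fun p => ?_
  rw [map_zero, Finsupp.zero_apply, ← h (PiTensorProduct.tprod ℚ fun i => b (p i))]
  clear h
  induction v using PiTensorProduct.induction_on with
  | add v w hv hw => rw [map_add, Finsupp.add_apply, hv, hw, add_mul, map_add]
  | smul_tprod r a =>
    rw [map_smul, Finsupp.smul_apply, Basis.piTensorProduct_repr_tprod_apply,
      smul_mul_assoc, map_smul, PiTensorProduct.tprod_mul_tprod, F.prodIntegral_tprod]
    simp [hb]

/-- The bilinear form of `A^{⊗I}` is non-degenerate. -/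
theorem tensorForm_injective (I : Type*) [Finite I] :
    Function.Injective (F.tensorForm I) := by
  have := Fintype.ofFinite I
  rw [← LinearMap.ker_eq_bot, LinearMap.ker_eq_bot']
  intro x hx
  obtain ⟨v, rfl⟩ := (F.tensorEquiv (enum I)).surjective x
  have hx' : ∀ w, F.prodIntegral I (F.rep (enum I) (F.ofTensor (enum I) v) w) = 0 := fun w => by
    rw [← F.tensorIntegral_ofTensor (enum I), F.ofTensor_rep]
    exact LinearMap.congr_fun hx (F.ofTensor (enum I) w)
  have hmem : ∀ i : I, i ∈ List.ofFn (enum I) := fun i =>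
    (List.mem_ofFn' _ _).2 ⟨(enum I).symm i, by simp⟩
  obtain ⟨ε, h0, hε⟩ := F.rep_pure_homogeneous (enum I) (List.nodup_ofFn.2 (enum I).injective)
  suffices v = 0 by rw [this, map_zero]
  refine F.prodIntegral_mul_eq_zero v fun w => ?_
  suffices F.prodIntegral I ∘ₗ LinearMap.mulLeft ℚ v = 0 from LinearMap.congr_fun this w
  refine homogeneous_ext (F := F) fun q b hb => ?_
  have key : (F.prodIntegral I ∘ₗ
      (F.rep (enum I)).toLinearMap.flip (PiTensorProduct.tprod ℚ b)) ∘ₗ F.ofTensor (enum I) =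
      ε (-q) q • (F.prodIntegral I ∘ₗ LinearMap.mulRight ℚ (PiTensorProduct.tprod ℚ b)) := by
    refine homogeneous_ext (F := F) fun p a ha => ?_
    simp only [LinearMap.comp_apply, LinearMap.flip_apply, AlgHom.toLinearMap_apply,
      LinearMap.smul_apply, LinearMap.mulRight_apply, F.ofTensor_tprod,
      hε p q a b ha hb, map_smul, hmem, if_true, PiTensorProduct.tprod_mul_tprod,
      F.prodIntegral_tprod, Pi.mul_apply]
    by_cases hpq : p = -q
    · rw [hpq]
    · obtain ⟨i, hi⟩ := Function.ne_iff.1 hpq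
      have : F.integral (a i * b i) = 0 := F.integral_eq_zero (F.mul_mem (ha i) (hb i)) (by
        simp only [Pi.neg_apply] at hi; omega)
      rw [Finset.prod_eq_zero (Finset.mem_univ i) this, smul_zero, smul_zero]
  have h1 := LinearMap.congr_fun key v
  simp only [LinearMap.comp_apply, LinearMap.flip_apply, AlgHom.toLinearMap_apply,
    hx', LinearMap.smul_apply, LinearMap.mulRight_apply, smul_eq_mul] at h1
  simpa [h0] using h1.symm

theorem finite_tensor (I : Type*) [Finite I] : Module.Finite ℚ (F.Tensor I) :=
  have := F.finite
  Module.Finite.equiv (F.tensorEquiv (enum I))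

/-! ### Push-forward and Euler class -/

/-- The adjoint `W → V` of a linear map `φ : V → W` with respect to the bilinear forms `B` on `V`
and `C` on `W`, of which `B` is non-degenerate. -/
def adjointMap {V W : Type*} [AddCommGroup V] [Module ℚ V] [AddCommGroup W] [Module ℚ W]
    (hV : Module.Finite ℚ V) (B : LinearMap.BilinForm ℚ V) (hB : Function.Injective B)
    (C : LinearMap.BilinForm ℚ W) (φ : V →ₗ[ℚ] W) : W →ₗ[ℚ] V :=
  (LinearMap.linearEquivOfInjective B hB Subspace.dual_finrank_eq.symm).symm.toLinearMap ∘ₗ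
    φ.dualMap ∘ₗ C

theorem adjointMap_spec {V W : Type*} [AddCommGroup V] [Module ℚ V] [AddCommGroup W] [Module ℚ W]
    (hV : Module.Finite ℚ V) (B : LinearMap.BilinForm ℚ V) (hB : Function.Injective B)
    (C : LinearMap.BilinForm ℚ W) (φ : V →ₗ[ℚ] W) (w : W) (v : V) :
    B (adjointMap hV B hB C φ w) v = C w (φ v) := by
  change (LinearMap.linearEquivOfInjective B hB Subspace.dual_finrank_eq.symm
    ((LinearMap.linearEquivOfInjective B hB Subspace.dual_finrank_eq.symm).symm _)) v = _
  rw [LinearEquiv.apply_symm_apply]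
  rfl

/-- The push-forward `φ_* : A^{⊗J} → A^{⊗I}`, adjoint to `φ^*`. -/
def push [Finite I] [Finite J] (φ : I → J) : F.Tensor J →ₗ[ℚ] F.Tensor I :=
  adjointMap (F.finite_tensor I) (F.tensorForm I) (F.tensorForm_injective I) (F.tensorForm J)
    (F.pull φ).toLinearMap

theorem push_spec [Finite I] [Finite J] (φ : I → J) (y : F.Tensor J) (x : F.Tensor I) :
    F.tensorIntegral I (F.push φ y * x) = F.tensorIntegral J (y * F.pull φ x) :=
  adjointMap_spec (F.finite_tensor I) (F.tensorForm I) (F.tensorForm_injective I)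
    (F.tensorForm J) (F.pull φ).toLinearMap y x

/-- The comultiplication `Δ_* : A → A ⊗ A`, adjoint to the multiplication. -/
def comul : A →ₗ[ℚ] F.Tensor (Fin 2) :=
  adjointMap (F.finite_tensor (Fin 2)) (F.tensorForm (Fin 2)) (F.tensorForm_injective (Fin 2))
    F.form (F.mulAll (Fin 2)).toLinearMap

/-- The Euler class: the image of `1` under comultiplication followed by multiplication. -/
def euler : A := F.mulAll (Fin 2) (F.comul 1)

/-- The element `e^ν = ⨂_{i ∈ I} e^{ν(i)}` of `A^{⊗I}`. -/
def eulerPow [Finite I] (ν : I → ℕ) : F.Tensor I :=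
  F.pure (List.ofFn (enum I)) fun i => F.euler ^ ν i

/-! ### Orbit spaces and the graph defect -/

/-- The orbit space `H \ [n]`. -/
abbrev Orbits {n : ℕ} (H : Subgroup (Equiv.Perm (Fin n))) : Type :=
  MulAction.orbitRel.Quotient H (Fin n)

/-- The surjection `H \ [n] → K \ [n]` of an inclusion `H ⊆ K`. -/
def orbitMap {n : ℕ} {H K : Subgroup (Equiv.Perm (Fin n))} (h : H ≤ K) : Orbits H → Orbits K :=
  Quotient.map' id (by
    rintro x y ⟨g, rfl⟩
    exact ⟨⟨g.1, h g.2⟩, rfl⟩)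

/-- The number `|H \ B|` of `H`-orbits contained in the `K`-orbit `B`, for `H ⊆ K`. -/
def orbitCount {n : ℕ} {H K : Subgroup (Equiv.Perm (Fin n))} (h : H ≤ K) (B : Orbits K) : ℕ :=
  Nat.card {C : Orbits H // orbitMap h C = B}

/-- The subgroup `⟨π, ρ⟩`. -/
abbrev pairGroup {n : ℕ} (π ρ : Equiv.Perm (Fin n)) : Subgroup (Equiv.Perm (Fin n)) :=
  Subgroup.closure {π, ρ}

theorem left_le {n : ℕ} (π ρ : Equiv.Perm (Fin n)) : Subgroup.zpowers π ≤ pairGroup π ρ :=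
  Subgroup.zpowers_le.2 (Subgroup.subset_closure (by simp))

theorem right_le {n : ℕ} (π ρ : Equiv.Perm (Fin n)) : Subgroup.zpowers ρ ≤ pairGroup π ρ :=
  Subgroup.zpowers_le.2 (Subgroup.subset_closure (by simp))

theorem mul_le {n : ℕ} (π ρ : Equiv.Perm (Fin n)) : Subgroup.zpowers (π * ρ) ≤ pairGroup π ρ :=
  Subgroup.zpowers_le.2 (MulMemClass.mul_mem (Subgroup.subset_closure (by simp))
    (Subgroup.subset_closure (by simp)))

/-- The graph defect `g(π, ρ) : ⟨π, ρ⟩ \ [n] → ℚ`. -/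
def graphDefect {n : ℕ} (π ρ : Equiv.Perm (Fin n)) (B : Orbits (pairGroup π ρ)) : ℚ :=
  ((Nat.card B.orbit : ℚ) + 2 - orbitCount (left_le π ρ) B - orbitCount (right_le π ρ) B -
    orbitCount (mul_le π ρ) B) / 2

/-! ### The algebra `A{S_n}` -/

/-- The vector space `A{S_n} = ⨁_π A^{⊗ ⟨π⟩ \ [n]} · π`. -/
abbrev SnAlgebra (n : ℕ) : Type _ :=
  DirectSum (Equiv.Perm (Fin n)) fun π => F.Tensor (Orbits (Subgroup.zpowers π))

/-- The element `a · π` of `A{S_n}`. -/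
def single {n : ℕ} (π : Equiv.Perm (Fin n)) :
    F.Tensor (Orbits (Subgroup.zpowers π)) →ₗ[ℚ] F.SnAlgebra n :=
  DirectSum.lof ℚ (Equiv.Perm (Fin n)) (fun π => F.Tensor (Orbits (Subgroup.zpowers π))) π

/-- The bilinear map
`m_{π,ρ}(a ⊗ b) = f_{⟨π,ρ⟩,πρ} (f^{π,⟨π,ρ⟩}(a) · f^{ρ,⟨π,ρ⟩}(b) · e^{g(π,ρ)})`. -/
def mulPerm {n : ℕ} (π ρ : Equiv.Perm (Fin n)) :
    F.Tensor (Orbits (Subgroup.zpowers π)) →ₗ[ℚ] F.Tensor (Orbits (Subgroup.zpowers ρ)) →ₗ[ℚ]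
      F.Tensor (Orbits (Subgroup.zpowers (π * ρ))) :=
  LinearMap.mk₂ ℚ
    (fun a b => F.push (orbitMap (mul_le π ρ))
      (F.pull (orbitMap (left_le π ρ)) a * F.pull (orbitMap (right_le π ρ)) b *
        F.eulerPow fun B => ⌊graphDefect π ρ B⌋₊))
    (fun a a' b => by simp only [map_add, add_mul])
    (fun c a b => by simp only [map_smul, smul_mul_assoc])
    (fun a b b' => by simp only [map_add, add_mul, mul_add])
    (fun c a b => by simp only [map_smul, smul_mul_assoc, mul_smul_comm])

/-- The product of `A{S_n}`, with `aπ · bρ = m_{π,ρ}(a ⊗ b) πρ`. -/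
def mulSn (n : ℕ) : F.SnAlgebra n →ₗ[ℚ] F.SnAlgebra n →ₗ[ℚ] F.SnAlgebra n :=
  DirectSum.toModule ℚ _ _ fun π => LinearMap.flip <| DirectSum.toModule ℚ _ _ fun ρ =>
    ((F.mulPerm π ρ).compr₂ (F.single (π * ρ))).flip

theorem mulSn_single {n : ℕ} (π ρ : Equiv.Perm (Fin n))
    (a : F.Tensor (Orbits (Subgroup.zpowers π))) (b : F.Tensor (Orbits (Subgroup.zpowers ρ))) :
    F.mulSn n (F.single π a) (F.single ρ b) = F.single (π * ρ) (F.mulPerm π ρ a b) := by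
  simp [mulSn, single]

/-- The bijection `⟨π⟩ \ [n] → ⟨σπσ⁻¹⟩ \ [n]`, `x ↦ σx`. -/
def orbitConj {n : ℕ} (σ π : Equiv.Perm (Fin n)) :
    Orbits (Subgroup.zpowers π) → Orbits (Subgroup.zpowers (σ * π * σ⁻¹)) :=
  Quotient.map' σ (by
    rintro x y ⟨⟨_, k, rfl⟩, rfl⟩
    refine ⟨⟨_, k, rfl⟩, ?_⟩
    change ((σ * π * σ⁻¹) ^ k) (σ y) = σ ((π ^ k) y)
    simp [conj_zpow])

/-- The action of `σ ∈ S_n` on `A{S_n}`, with `aπ ↦ σ^*(a) σπσ⁻¹`. -/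
def actSn {n : ℕ} (σ : Equiv.Perm (Fin n)) : F.SnAlgebra n →ₗ[ℚ] F.SnAlgebra n :=
  DirectSum.toModule ℚ _ _ fun π =>
    F.single (σ * π * σ⁻¹) ∘ₗ (F.pull (orbitConj σ π)).toLinearMap

/-- The part of degree `m` of `A{S_n}`, where `|a π| = |a|`. -/
def grSn (n : ℕ) (m : ℤ) : Submodule ℚ (F.SnAlgebra n) :=
  ⨅ π : Equiv.Perm (Fin n), (F.tensorGr (Orbits (Subgroup.zpowers π)) m).comap
    (DirectSum.component ℚ (Equiv.Perm (Fin n))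
      (fun π => F.Tensor (Orbits (Subgroup.zpowers π))) π)

end

end GradedFrobenius

/-!
Write `S(π)` for the partition of `[n]` into the orbits of `π`.

The basic objects are the diagonal classes `diag i j ∈ A^{⊗I}`: the class `Δ_* 1 ∈ A ⊗ A`, placed
in the factors `i` and `j`. Since `Δ_* 1` has degree `0` they are central; `diag i i` is the Euler
class in the factor `i`, and for `i ≠ j` the class `diag i j` is `χ_* 1`, where `χ` is the
surjection that identifies `i` and `j` (`push_one_of_merge`). A multigraph with vertex set `I` has
a class `edgeProd E`, the product of `diag i j` over its edges. By contraction of the edges one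
after the other, with the projection formula, this class is `φ_* e^b`, where `φ` is the map from `I`
to the set of connected components and `b` is the family of their first Betti numbers
(`exists_edgeProd_eq_push`). So it only depends on the components and on the number of edges in each
of them (`pull_edgeProd_congr`), and it is compatible with all maps `φ^*`.

For `π, ρ ∈ S_n` there is a list `E(π, ρ)` of edges on `[n]` for which the graph induced on
`⟨πρ⟩ \ [n]` has `⟨π, ρ⟩ \ [n]` as its set of components, with the graph defects as first Betti
numbers (`IsDefectGraph`, `exists_isDefectGraph`, `exists_graphDefect_eq`): take a minimal
factorization of `ρ` into transpositions, multiply them onto `π` one after the other, and keep those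
that split an orbit, as opposed to those that merge two orbits. In particular the graph defect is a
non-negative integer. Moreover, as `A^{⊗[n]} → A^{⊗⟨π⟩\[n]}` is surjective, the product of `A{S_n}`
is determined by the formula `x π · y ρ = E(π, ρ) x y πρ` for `x, y ∈ A^{⊗[n]}`
(`mulSn_singlePull`).

Associativity is then the cocycle condition `E(πρ, τ) E(π, ρ) = E(π, ρτ) E(ρ, τ)` in
`A^{⊗⟨πρτ⟩\[n]}`. It holds because both graphs have `⟨π, ρ, τ⟩ \ [n]` as set of components, and in
a component `B` both have `(2|B| - |S(π)| - |S(ρ)| - |S(τ)| + |S(πρτ)|) / 2` edges, where `|S|`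
counts the blocks in `B`. Equivariance holds because `σ E(π, ρ)` has the properties that
characterize `E(σπσ⁻¹, σρσ⁻¹)`. Homogeneity is a count of degrees: multiplication by a diagonal
class raises the degree by `2d`, and `φ^* : A^{⊗I} → A^{⊗J}` raises it by `(|I| - |J|) d`.
-/

namespace GradedFrobenius

noncomputable section

/-! ### The maps `φ^*` and graded commutativity -/

section Tensor

variable {A : Type*} [Ring A] [Algebra ℚ A] {d : ℕ} (F : GradedFrobenius A d)
variable {ι I J K : Type*}

theorem incl_mul_incl_comm (i j : I) {p q : ℤ} {a b : A} (ha : a ∈ F.gr p) (hb : b ∈ F.gr q) :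
    F.incl i a * F.incl j b = ((-1 : ℚ) ^ (p * q)) • (F.incl j b * F.incl i a) := by
  by_cases h : i = j
  · rw [h, ← map_mul, ← map_mul, F.graded_comm ha hb, map_smul]
  · exact F.incl_mul_incl h ha hb

@[simp]
theorem pull_incl (φ : I → J) (i : I) (a : A) : F.pull φ (F.incl i a) = F.incl (φ i) a :=
  F.liftHom_incl _ _ _ _

@[simp]
theorem mulAll_incl (i : I) (a : A) : F.mulAll I (F.incl i a) = a :=
  F.liftHom_incl _ _ _ _

theorem algHom_ext {B : Type*} [Ring B] [Algebra ℚ B] {f g : F.Tensor I →ₐ[ℚ] B}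
    (h : ∀ i a, f (F.incl i a) = g (F.incl i a)) : f = g := by
  refine AlgHom.ext fun x => ?_
  refine F.tensor_induction (P := fun x => f x = g x) (by simp) (fun i a x hx => ?_)
    (fun x y hx hy => ?_) (fun c x hx => ?_) x
  · rw [map_mul, map_mul, h, hx]
  · rw [map_add, map_add, hx, hy]
  · rw [map_smul, map_smul, hx]

theorem pull_pull (φ : I → J) (ψ : J → K) (x : F.Tensor I) :
    F.pull ψ (F.pull φ x) = F.pull (ψ ∘ φ) x := by
  rw [← AlgHom.comp_apply]
  exact DFunLike.congr_fun (F.algHom_ext fun i a => by simp) x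

theorem pull_surjective {φ : I → J} (hφ : Function.Surjective φ) :
    Function.Surjective (F.pull φ) := by
  intro y
  refine F.tensor_induction (P := fun y => ∃ x, F.pull φ x = y) ⟨1, map_one _⟩ ?_ ?_ ?_ y
  · rintro j a _ ⟨x, rfl⟩
    obtain ⟨i, rfl⟩ := hφ j
    exact ⟨F.incl i a * x, by simp⟩
  · rintro _ _ ⟨x, rfl⟩ ⟨y, rfl⟩
    exact ⟨x + y, map_add _ _ _⟩
  · rintro c _ ⟨x, rfl⟩
    exact ⟨c • x, map_smul _ _ _⟩

theorem pull_pure (φ : I → J) (l : List I) (a : I → A) :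
    F.pull φ (F.pure l a) = (l.map fun i => F.incl (φ i) (a i)).prod := by
  simp [pure, map_list_prod, List.map_map, Function.comp_def]

theorem list_prod_mul_incl (l : List ι) (f : ι → I) {a : ι → A} {k : ι → ℤ}
    (ha : ∀ i, a i ∈ F.gr (k i)) (j : I) {q : ℤ} {c : A} (hc : c ∈ F.gr q) :
    (l.map fun i => F.incl (f i) (a i)).prod * F.incl j c =
      ((-1 : ℚ) ^ ((l.map k).sum * q)) •
        (F.incl j c * (l.map fun i => F.incl (f i) (a i)).prod) := by
  induction l with
  | nil => simp
  | cons i l ih =>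
    simp only [List.map_cons, List.prod_cons, List.sum_cons]
    rw [mul_assoc, ih, mul_smul_comm, ← mul_assoc, F.incl_mul_incl_comm (f i) j (ha i) hc,
      smul_mul_assoc, smul_smul, mul_assoc, add_mul, zpow_add₀ (by norm_num), mul_comm]

/-! ### The grading of `A^{⊗I}` -/

theorem incl_mul_mem_tensorGr (i : I) {k m : ℤ} {c : A} (hc : c ∈ F.gr k) {x : F.Tensor I}
    (hx : x ∈ F.tensorGr I m) : F.incl i c * x ∈ F.tensorGr I (m + (k + d)) := by
  classical
  induction hx using Submodule.span_induction with
  | zero => rw [mul_zero]; exact zero_mem _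
  | add x y _ _ hx hy => rw [mul_add]; exact add_mem hx hy
  | smul r x _ hx => rw [mul_smul_comm]; exact Submodule.smul_mem _ _ hx
  | mem x hx =>
    obtain ⟨l, p, a, hl, hmem, ha, rfl, rfl⟩ := hx
    obtain ⟨l₁, l₂, rfl⟩ := List.append_of_mem (hmem i)
    have hnd := List.nodup_append.1 hl
    have h₁ : i ∉ l₁ := fun h => hnd.2.2 i h i (by simp) rfl
    have h₂ : i ∉ l₂ := (List.nodup_cons.1 hnd.2.1).1
    refine Submodule.subset_span ⟨l₁ ++ i :: l₂, Function.update p i (k + p i + d),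
      fun j => if j = i then c * a i else if j ∈ l₁ then F.signOp k (a j) else a j,
      hl, hmem, fun j => ?_, ?_, ?_⟩
    · by_cases hj : j = i
      · subst hj
        simpa using F.mul_mem hc (ha j)
      · simp only [hj, if_false, Function.update_of_ne hj]
        split_ifs
        · exact F.signOp_mem k (ha j)
        · exact ha j
    · have e : ∀ l : List I, i ∉ l → l.map (Function.update p i (k + p i + d)) = l.map p :=
        fun l h => List.map_congr_left fun j hj =>
          Function.update_of_ne (by rintro rfl; exact h hj) _ _
      simp only [List.map_append, List.map_cons, e l₁ h₁, e l₂ h₂, Function.update_self,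
        List.sum_append, List.sum_cons]
      ring
    · have e : ∀ b : I → A, F.pure (l₁ ++ i :: l₂) b =
          F.pure l₁ b * (F.incl i (b i) * F.pure l₂ b) := by
        intro b; simp [pure]
      rw [e, e, ← mul_assoc, F.incl_mul_prod h₁ hc, if_pos rfl, map_mul]
      have e₁ : F.pure l₁ (fun j => F.signOp k (a j)) = F.pure l₁ (fun j =>
          if j = i then c * a i else if j ∈ l₁ then F.signOp k (a j) else a j) :=
        F.pure_congr fun j hj => by rw [if_neg (by rintro rfl; exact h₁ hj), if_pos hj]
      have e₂ : F.pure l₂ a = F.pure l₂ (fun j =>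
          if j = i then c * a i else if j ∈ l₁ then F.signOp k (a j) else a j) :=
        F.pure_congr fun j hj => by
          have h3 : j ∉ l₁ := fun h => hnd.2.2 j h j (by simp [hj]) rfl
          rw [if_neg (by rintro rfl; exact h₂ hj), if_neg h3]
      rw [← e₁, ← e₂]
      simp only [mul_assoc]

theorem list_prod_mul_mem_tensorGr (l : List ι) (f : ι → I) {a : ι → A} {k : ι → ℤ}
    (ha : ∀ i, a i ∈ F.gr (k i)) {m : ℤ} {x : F.Tensor I} (hx : x ∈ F.tensorGr I m) :
    (l.map fun i => F.incl (f i) (a i)).prod * x ∈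
      F.tensorGr I (m + ((l.map k).sum + l.length * d)) := by
  induction l with
  | nil => simpa using hx
  | cons i l ih =>
    simp only [List.map_cons, List.prod_cons, List.sum_cons, List.length_cons]
    rw [mul_assoc]
    convert F.incl_mul_mem_tensorGr (f i) (ha i) ih using 1
    push_cast
    ring_nf

theorem length_eq_card {l : List I} (hl : l.Nodup) (h : ∀ i, i ∈ l) : l.length = Nat.card I := by
  classical
  simpa using Nat.card_congr (hl.getEquivOfForallMemList l h)

theorem nodup_ofFn_enum (I : Type*) [Finite I] : (List.ofFn (enum I)).Nodup :=
  List.nodup_ofFn.2 (enum I).injective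

theorem mem_ofFn_enum [Finite I] (i : I) : i ∈ List.ofFn (enum I) :=
  (List.mem_ofFn' _ _).2 ⟨(enum I).symm i, by simp⟩

theorem pure_one (l : List I) : F.pure l (fun _ => 1) = 1 := by
  simp only [pure, map_one, List.map_const', List.prod_replicate, one_pow]

theorem one_mem_tensorGr (I : Type*) [Finite I] : 1 ∈ F.tensorGr I (-(Nat.card I * d)) := by
  refine Submodule.subset_span ⟨List.ofFn (enum I), fun _ => -d, fun _ => 1, nodup_ofFn_enum I,
    mem_ofFn_enum, fun _ => F.one_mem, ?_, (F.pure_one _).symm⟩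
  rw [List.map_const', List.sum_replicate, List.length_ofFn]
  simp

theorem mul_mem_tensorGr [Finite I] {p q : ℤ} {x y : F.Tensor I} (hx : x ∈ F.tensorGr I p)
    (hy : y ∈ F.tensorGr I q) : x * y ∈ F.tensorGr I (p + q + Nat.card I * d) := by
  induction hx using Submodule.span_induction with
  | zero => rw [zero_mul]; exact zero_mem _
  | add x y _ _ hx hy => rw [add_mul]; exact add_mem hx hy
  | smul r x _ hx => rw [smul_mul_assoc]; exact Submodule.smul_mem _ _ hx
  | mem x hx =>
    obtain ⟨l, k, a, hl, hmem, ha, rfl, rfl⟩ := hx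
    convert F.list_prod_mul_mem_tensorGr l id ha hy using 1
    · rw [length_eq_card hl hmem]
      ring_nf
    · rfl

theorem pull_mem_tensorGr [Finite I] [Finite J] (φ : I → J) {p : ℤ} {x : F.Tensor I}
    (hx : x ∈ F.tensorGr I p) :
    F.pull φ x ∈ F.tensorGr J (p + Nat.card I * d - Nat.card J * d) := by
  induction hx using Submodule.span_induction with
  | zero => rw [map_zero]; exact zero_mem _
  | add x y _ _ hx hy => rw [map_add]; exact add_mem hx hy
  | smul r x _ hx => rw [map_smul]; exact Submodule.smul_mem _ _ hx
  | mem x hx =>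
    obtain ⟨l, k, a, hl, hmem, ha, rfl, rfl⟩ := hx
    rw [F.pull_pure]
    have := F.list_prod_mul_mem_tensorGr l φ ha (F.one_mem_tensorGr J)
    rw [mul_one, length_eq_card hl hmem] at this
    convert this using 1
    ring_nf

theorem mulAll_mem_gr [Finite I] {p : ℤ} {x : F.Tensor I} (hx : x ∈ F.tensorGr I p) :
    F.mulAll I x ∈ F.gr (p + Nat.card I * d - d) := by
  induction hx using Submodule.span_induction with
  | zero => rw [map_zero]; exact zero_mem _
  | add x y _ _ hx hy => rw [map_add]; exact add_mem hx hy
  | smul r x _ hx => rw [map_smul]; exact Submodule.smul_mem _ _ hx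
  | mem x hx =>
    obtain ⟨l, k, a, hl, hmem, ha, rfl, rfl⟩ := hx
    rw [← length_eq_card hl hmem, pure, map_list_prod, List.map_map]
    clear hl hmem
    induction l with
    | nil => simpa using F.one_mem
    | cons i l ih =>
      simp only [List.map_cons, List.prod_cons, List.sum_cons, List.length_cons,
        Function.comp_apply, mulAll_incl] at ih ⊢
      convert F.mul_mem (ha i) ih using 1
      push_cast
      ring_nf

theorem iSup_tensorGr (I : Type*) [Finite I] : ⨆ m, F.tensorGr I m = ⊤ := by
  rw [eq_top_iff]
  intro x _
  refine F.tensor_induction (P := fun x => x ∈ ⨆ m, F.tensorGr I m)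
    (Submodule.mem_iSup_of_mem _ (F.one_mem_tensorGr I)) (fun i a x hx => ?_)
    (fun x y hx hy => add_mem hx hy) (fun c x hx => Submodule.smul_mem _ _ hx) x
  induction a using F.hom_induction with
  | hadd a b ha hb => rw [map_add, add_mul]; exact add_mem ha hb
  | h k a ha =>
    refine Submodule.iSup_induction (F.tensorGr I)
      (motive := fun x => F.incl i a * x ∈ ⨆ m, F.tensorGr I m) hx (fun m x hx => ?_) ?_
      fun x y hx hy => ?_
    · exact Submodule.mem_iSup_of_mem _ (F.incl_mul_mem_tensorGr i ha hx)
    · rw [mul_zero]; exact zero_mem _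
    · rw [mul_add]; exact add_mem hx hy

theorem tensorIntegral_eq_zero [Finite I] {m : ℤ} {x : F.Tensor I} (hx : x ∈ F.tensorGr I m)
    (hm : m ≠ Nat.card I * d) : F.tensorIntegral I x = 0 := by
  have := Fintype.ofFinite I
  induction hx using Submodule.span_induction with
  | zero => rw [map_zero]
  | add x y _ _ hx hy => rw [map_add, hx, hy, add_zero]
  | smul r x _ hx => rw [map_smul, hx, smul_zero]
  | mem x hx =>
    obtain ⟨l, k, a, hl, hmem, ha, rfl, rfl⟩ := hx
    obtain ⟨i, hi⟩ : ∃ i, k i ≠ d := by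
      by_contra! h
      apply hm
      rw [← length_eq_card hl hmem, funext h]
      simp
    rw [F.tensorIntegral_pure hl hmem, Finset.prod_eq_zero (Finset.mem_univ i)
      (F.integral_eq_zero (ha i) hi)]

/-- `A^{⊗I}` is spanned by the tensors `a_{l₁} ⊗ ⋯ ⊗ a_{lₙ}`, for a fixed enumeration `l`. -/
theorem pure_induction {l : List I} (hl : l.Nodup) (h : ∀ i, i ∈ l) {P : F.Tensor I → Prop}
    (hpure : ∀ a, P (F.pure l a)) (hadd : ∀ x y, P x → P y → P (x + y))
    (hsmul : ∀ (c : ℚ) x, P x → P (c • x)) (x : F.Tensor I) : P x := by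
  classical
  obtain ⟨v, rfl⟩ := (F.tensorEquiv (hl.getEquivOfForallMemList l h)).surjective x
  induction v using PiTensorProduct.induction_on with
  | add v w hv hw => rw [map_add]; exact hadd _ _ hv hw
  | smul_tprod r a =>
    rw [map_smul, tensorEquiv_tprod]
    refine hsmul _ _ ?_
    have : List.ofFn (hl.getEquivOfForallMemList l h) = l := List.ofFn_get l
    rw [this]
    exact hpure a

/-! ### Push-forward -/

theorem tensorIntegral_ext [Finite I] {x y : F.Tensor I}
    (h : ∀ z, F.tensorIntegral I (x * z) = F.tensorIntegral I (y * z)) : x = y :=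
  F.tensorForm_injective I (LinearMap.ext h)

theorem push_eq_of_forall [Finite I] [Finite J] {φ : I → J} {y : F.Tensor J} {z : F.Tensor I}
    (h : ∀ x, F.tensorIntegral I (z * x) = F.tensorIntegral J (y * F.pull φ x)) :
    F.push φ y = z :=
  F.tensorIntegral_ext fun x => by rw [push_spec, h]

/-- The projection formula. -/
theorem push_mul_pull [Finite I] [Finite J] (φ : I → J) (y : F.Tensor J) (x : F.Tensor I) :
    F.push φ (y * F.pull φ x) = F.push φ y * x :=
  F.push_eq_of_forall fun z => by
    rw [mul_assoc, push_spec, map_mul (F.pull φ), mul_assoc]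

theorem push_push [Finite I] [Finite J] [Finite K] (φ : I → J) (ψ : J → K) (z : F.Tensor K) :
    F.push φ (F.push ψ z) = F.push (ψ ∘ φ) z :=
  (F.push_eq_of_forall fun x => by rw [push_spec, push_spec, pull_pull]).symm

theorem push_one_of_bijective [Finite I] [Finite J] {φ : I → J} (hφ : Function.Bijective φ) :
    F.push φ 1 = 1 := by
  have := Fintype.ofFinite I
  have := Fintype.ofFinite J
  refine F.push_eq_of_forall fun x => ?_
  rw [one_mul, one_mul]
  refine F.pure_induction (P := fun x => F.tensorIntegral I x = F.tensorIntegral J (F.pull φ x))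
    (nodup_ofFn_enum I) mem_ofFn_enum (fun a => ?_) (fun x y hx hy => ?_) (fun c x hx => ?_) x
  · obtain ⟨ψ, h₁, h₂⟩ := Function.bijective_iff_has_inverse.1 hφ
    have e : F.pull φ (F.pure (List.ofFn (enum I)) a) =
        F.pure ((List.ofFn (enum I)).map φ) (a ∘ ψ) := by
      rw [pull_pure, pure, List.map_map]
      simp only [Function.comp_def, h₁ _]
    rw [e, F.tensorIntegral_pure (nodup_ofFn_enum I) mem_ofFn_enum, F.tensorIntegral_pure
      ((nodup_ofFn_enum I).map hφ.1) fun j => List.mem_map.2 ⟨ψ j, mem_ofFn_enum _, h₂ j⟩]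
    exact Fintype.prod_bijective φ hφ _ _ fun i => by simp [h₁ i]
  · rw [map_add, map_add, map_add, hx, hy]
  · rw [map_smul, map_smul, map_smul, hx]

/-! ### The diagonal classes -/

theorem comul_spec (a : A) (x : F.Tensor (Fin 2)) :
    F.tensorIntegral (Fin 2) (F.comul a * x) = F.integral (a * F.mulAll (Fin 2) x) :=
  adjointMap_spec (F.finite_tensor (Fin 2)) (F.tensorForm (Fin 2)) (F.tensorForm_injective (Fin 2))
    F.form (F.mulAll (Fin 2)).toLinearMap a x

/-- The class `Δ_* 1` has degree `0`: its components in other degrees pair to zero with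
everything. -/
theorem comul_one_mem : F.comul 1 ∈ F.tensorGr (Fin 2) 0 := by
  classical
  have htop : F.comul 1 ∈ ⨆ m, F.tensorGr (Fin 2) m := by rw [iSup_tensorGr]; trivial
  obtain ⟨z, hz, hsum⟩ := (Submodule.mem_iSup_iff_exists_finsupp _ _).1 htop
  have hzero : ∀ m ≠ 0, z m = 0 := by
    intro m hm
    refine F.tensorIntegral_ext fun w => ?_
    rw [zero_mul, map_zero]
    have hw : w ∈ ⨆ m, F.tensorGr (Fin 2) m := by rw [iSup_tensorGr]; trivial
    refine Submodule.iSup_induction (F.tensorGr (Fin 2))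
      (motive := fun w => F.tensorIntegral (Fin 2) (z m * w) = 0) hw (fun q w hw => ?_) (by simp)
      fun x y hx hy => by rw [mul_add, map_add, hx, hy, add_zero]
    have horth : ∀ p, p + q ≠ 0 → F.tensorIntegral (Fin 2) (z p * w) = 0 := fun p hp =>
      F.tensorIntegral_eq_zero (F.mul_mem_tensorGr (hz p) hw) (by omega)
    by_cases hq : m + q = 0
    · have h1 : F.tensorIntegral (Fin 2) (F.comul 1 * w) = 0 := by
        rw [comul_spec, one_mul]
        refine F.integral_eq_zero (F.mulAll_mem_gr hw) ?_
        simp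
        omega
      rw [← hsum, Finsupp.sum, Finset.sum_mul, map_sum] at h1
      rw [← h1]
      by_cases hm' : m ∈ z.support
      · exact (Finset.sum_eq_single_of_mem m hm' fun p _ hp => horth p (by omega)).symm
      · rw [Finset.sum_eq_zero fun p hp => horth p ?_, Finsupp.notMem_support_iff.1 hm', zero_mul,
          map_zero]
        have : p ≠ m := by rintro rfl; exact hm' hp
        omega
    · exact horth m hq
  rw [← hsum, Finsupp.sum]
  refine sum_mem fun m _ => ?_
  by_cases hm : m = 0
  · exact hm ▸ hz m
  · rw [hzero m hm]; exact zero_mem _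

/-- The class of the diagonal `i = j` in `A^{⊗I}`: the class `Δ_* 1 ∈ A ⊗ A`, placed in the
factors `i` and `j`. For `i = j` it is the Euler class in the factor `i`, see `diag_self`. -/
def diag (i j : I) : F.Tensor I := F.pull ![i, j] (F.comul 1)

theorem diag_commute (i j : I) (x : F.Tensor I) : Commute (F.diag i j) x := by
  refine F.tensor_induction (P := fun x => Commute (F.diag i j) x) (Commute.one_right _)
    (fun k c x hx => ?_) (fun x y hx hy => hx.add_right hy) (fun c x hx => hx.smul_right c) x
  refine Commute.mul_right ?_ hx
  induction c using F.hom_induction with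
  | hadd a b ha hb => rw [map_add]; exact ha.add_right hb
  | h q c hc =>
    refine Submodule.span_induction
      (p := fun y _ => Commute (F.pull ![i, j] y) (F.incl k c)) ?_ ?_ ?_ ?_ F.comul_one_mem
    · rintro _ ⟨l, p, a, _, _, ha, hsum, rfl⟩
      rw [Commute, SemiconjBy, pull_pure, F.list_prod_mul_incl l _ ha k hc, hsum]
      simp
    · rw [map_zero]; exact Commute.zero_left _
    · intro x y _ _ hx hy; rw [map_add]; exact hx.add_left hy
    · intro r x _ hx; rw [map_smul]; exact hx.smul_left r

theorem pull_diag (φ : I → J) (i j : I) : F.pull φ (F.diag i j) = F.diag (φ i) (φ j) := by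
  rw [diag, pull_pull, diag]
  congr 2
  funext k
  fin_cases k <;> rfl

theorem diag_self (i : I) : F.diag i i = F.incl i F.euler := by
  have : F.pull ![i, i] = (F.incl i).comp (F.mulAll (Fin 2)) := F.algHom_ext fun k a => by
    fin_cases k <;> simp
  rw [diag, this]
  rfl

theorem diag_mem_tensorGr [Finite I] (i j : I) :
    F.diag i j ∈ F.tensorGr I (2 * d - Nat.card I * d) := by
  have := F.pull_mem_tensorGr ![i, j] F.comul_one_mem
  rwa [zero_add, Nat.card_fin] at this

/-- If `φ` identifies `i` and `j` and nothing else, then `φ_* 1` is the class of the diagonal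
`i = j`. -/
theorem push_one_of_merge [Finite I] [Finite J] {φ : I → J} (hφ : Function.Surjective φ) {i j : I}
    (hij : i ≠ j) (hφij : φ i = φ j) (hinj : ∀ x y, x ≠ j → y ≠ j → φ x = φ y → x = y) :
    F.push φ 1 = F.diag i j := by
  classical
  have := Fintype.ofFinite I
  have := Fintype.ofFinite J
  obtain ⟨r, hr, hmem⟩ : ∃ r : List I, (i :: j :: r).Nodup ∧ ∀ x, x ∈ i :: j :: r := by
    refine ⟨((Finset.univ.erase i).erase j).toList, ?_, fun x => ?_⟩
    · simp [hij, Finset.nodup_toList]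
    · simp only [List.mem_cons, Finset.mem_toList, Finset.mem_erase, Finset.mem_univ, and_true]
      tauto
  have hr' := hr
  simp only [List.nodup_cons, List.mem_cons, not_or] at hr'
  obtain ⟨⟨-, hir⟩, hjr, hrn⟩ := hr'
  refine F.push_eq_of_forall fun x => ?_
  rw [one_mul]
  refine F.pure_induction (P := fun x =>
    F.tensorIntegral I (F.diag i j * x) = F.tensorIntegral J (F.pull φ x)) hr hmem (fun a => ?_)
    (fun x y hx hy => ?_) (fun c x hx => ?_) x
  · -- the tensor with `b` in the factors `i`, `j` and `a` elsewhere
    have key : ∀ z : F.Tensor (Fin 2), F.tensorIntegral I (F.pull ![i, j] z * F.pure r a) =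
        F.tensorIntegral (Fin 2) z * (r.map fun i => F.integral (a i)).prod := by
      refine F.pure_induction (l := [0, 1]) (by simp) (by intro i; fin_cases i <;> simp)
        (fun b => ?_) (fun x y hx hy => ?_) (fun c x hx => ?_)
      · let b' : I → A := Function.update (Function.update a i (b 0)) j (b 1)
        have hb' : ∀ x ∈ r, b' x = a x := fun x hx => by
          have h1 : x ≠ i := by rintro rfl; exact hir hx
          have h2 : x ≠ j := by rintro rfl; exact hjr hx
          simp [b', h1, h2]
        have e : F.pull ![i, j] (F.pure [0, 1] b) * F.pure r a = F.pure (i :: j :: r) b' := by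
          rw [← F.pure_congr hb']
          simp [pure, b', hij, mul_assoc]
        rw [e, F.tensorIntegral_pure hr hmem,
          F.tensorIntegral_pure (by simp) (by intro i; fin_cases i <;> simp), Fin.prod_univ_two,
          ← (show (i :: j :: r).toFinset = Finset.univ by ext x; simpa using hmem x),
          List.prod_toFinset _ hr]
        have e' : r.map (fun x => F.integral (b' x)) = r.map fun x => F.integral (a x) :=
          List.map_congr_left fun x hx => by rw [hb' x hx]
        rw [List.map_cons, List.map_cons, e']
        simp [b', hij, mul_assoc]
      · simp only [map_add, add_mul, hx, hy]
      · simp only [map_smul, smul_mul_assoc, hx]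
    have e1 : F.diag i j * F.pure (i :: j :: r) a =
        F.pull ![i, j] (F.comul 1 * F.pure [0, 1] ![a i, a j]) * F.pure r a := by
      rw [map_mul, pull_pure, diag]
      simp [pure, mul_assoc]
    have e2 : F.tensorIntegral (Fin 2) (F.comul 1 * F.pure [0, 1] ![a i, a j]) =
        F.integral (a i * a j) := by
      rw [comul_spec]
      simp [pure]
    rw [e1, key, e2]
    -- a section of `φ` on `I \ {j}`
    obtain ⟨s, hs⟩ : ∃ s : J → I, ∀ x, x ≠ j → s (φ x) = x := by
      have : ∀ y : J, ∃ x, x ≠ j ∧ φ x = y := fun y => by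
        obtain ⟨x, rfl⟩ := hφ y
        by_cases h : x = j
        · exact ⟨i, hij, by rw [h, hφij]⟩
        · exact ⟨x, h, rfl⟩
      choose s hs hs' using this
      exact ⟨s, fun x hx => hinj _ _ (hs _) hx (hs' _)⟩
    have hnj : ∀ x ∈ i :: r, x ≠ j := by
      intro x hx
      rcases List.mem_cons.1 hx with rfl | hx
      · exact hij
      · rintro rfl; exact hjr hx
    have hnd : ((i :: r).map φ).Nodup :=
      List.Nodup.map_on (fun x hx y hy h => hinj x y (hnj x hx) (hnj y hy) h)
        (List.nodup_cons.2 ⟨hir, hrn⟩)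
    have hall : ∀ y, y ∈ (i :: r).map φ := fun y => by
      obtain ⟨x, rfl⟩ := hφ y
      have := hmem x
      simp only [List.mem_cons] at this
      rcases this with rfl | rfl | h
      · simp
      · simp [hφij]
      · simp only [List.map_cons, List.mem_cons, List.mem_map]
        exact Or.inr ⟨x, h, rfl⟩
    let b : J → A := fun y => if y = φ i then a i * a j else a (s y)
    have hb : ∀ x ∈ r, b (φ x) = a x := fun x hx => by
      have hne : φ x ≠ φ i := fun h =>
        hir (hinj x i (hnj x (by simp [hx])) hij h ▸ hx)
      simp only [b, if_neg hne, hs x (hnj x (by simp [hx]))]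
    have e3 : F.pull φ (F.pure (i :: j :: r) a) = F.pure ((i :: r).map φ) b := by
      rw [pull_pure]
      simp only [pure, List.map_cons, List.prod_cons, List.map_map, ← hφij, ← mul_assoc,
        ← map_mul]
      congr 2
      · simp [b]
      · exact List.map_congr_left fun x hx => by simp [hb x hx]
    rw [e3, F.tensorIntegral_pure hnd hall,
      ← (show ((i :: r).map φ).toFinset = Finset.univ by ext x; simpa using hall x),
      List.prod_toFinset _ hnd]
    simp only [List.map_cons, List.prod_cons, List.map_map]
    congr 2
    · simp [b]
    · exact List.map_congr_left fun x hx => by simp [hb x hx]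
  · rw [mul_add, map_add, map_add, map_add, hx, hy]
  · rw [mul_smul_comm, map_smul, map_smul, map_smul, hx]

/-! ### Powers of the Euler class -/

theorem commute_incl_euler (i : I) (x : F.Tensor I) : Commute (F.incl i F.euler) x :=
  F.diag_self i ▸ F.diag_commute i i x

@[simp]
theorem eulerPow_zero [Finite I] : F.eulerPow (0 : I → ℕ) = 1 := by
  simp only [eulerPow, Pi.zero_apply, pow_zero, pure_one]

theorem eulerPow_commute [Finite I] (ν : I → ℕ) (x : F.Tensor I) : Commute (F.eulerPow ν) x := by
  refine Commute.list_prod_left _ _ fun y hy => ?_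
  obtain ⟨i, -, rfl⟩ := List.mem_map.1 hy
  rw [map_pow]
  exact (F.commute_incl_euler i x).pow_left _

theorem eulerPow_add_single [Finite I] [DecidableEq I] (ν : I → ℕ) (i : I) :
    F.eulerPow (ν + Pi.single i 1) = F.eulerPow ν * F.incl i F.euler := by
  obtain ⟨l₁, l₂, h⟩ := List.append_of_mem (mem_ofFn_enum i)
  have hnd := nodup_ofFn_enum I
  rw [h] at hnd
  have hnd := List.nodup_append.1 hnd
  have h₁ : i ∉ l₁ := fun h => hnd.2.2 i h i (by simp) rfl
  have h₂ : i ∉ l₂ := (List.nodup_cons.1 hnd.2.1).1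
  have e : ∀ b : I → A, F.pure (l₁ ++ i :: l₂) b =
      F.pure l₁ b * (F.incl i (b i) * F.pure l₂ b) := by
    intro b; simp [pure]
  have hl : ∀ l : List I, i ∉ l → F.pure l (fun j => F.euler ^ (ν + Pi.single i 1 : I → ℕ) j) =
      F.pure l fun j => F.euler ^ ν j := fun l hl => F.pure_congr fun j hj => by
    have : j ≠ i := by rintro rfl; exact hl hj
    simp [this]
  rw [eulerPow, eulerPow, h, e, e, hl l₁ h₁, hl l₂ h₂]
  simp only [Pi.add_apply, Pi.single_eq_same, pow_succ, map_mul, mul_assoc]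
  rw [(F.commute_incl_euler i (F.pure l₂ _)).eq]

end Tensor

/-! ### Multigraphs -/

section Graph

universe u

variable {V W : Type*}

/-- The partition into connected components of the multigraph with vertex set `V` and list of
edges `E`. -/
def edgeSetoid (E : List (V × V)) : Setoid V := Relation.EqvGen.setoid fun x y => (x, y) ∈ E

theorem edgeSetoid_le_iff {E : List (V × V)} {r : Setoid V} :
    edgeSetoid E ≤ r ↔ ∀ e ∈ E, r e.1 e.2 :=
  ⟨fun h e he => h (Relation.EqvGen.rel e.1 e.2 he),
    fun h => Setoid.eqvGen_le fun x y he => h (x, y) he⟩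

theorem edgeSetoid_rel {E : List (V × V)} {e : V × V} (he : e ∈ E) : edgeSetoid E e.1 e.2 :=
  edgeSetoid_le_iff.1 le_rfl e he

theorem edgeSetoid_nil : edgeSetoid ([] : List (V × V)) = ⊥ :=
  le_bot_iff.1 (edgeSetoid_le_iff.2 (by simp))

theorem edgeSetoid_append (E E' : List (V × V)) :
    edgeSetoid (E ++ E') = edgeSetoid E ⊔ edgeSetoid E' :=
  eq_of_forall_ge_iff fun r => by
    simp only [sup_le_iff, edgeSetoid_le_iff, List.mem_append, or_imp, forall_and]

theorem edgeSetoid_cons (e : V × V) (E : List (V × V)) :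
    edgeSetoid (e :: E) = edgeSetoid [e] ⊔ edgeSetoid E :=
  edgeSetoid_append [e] E

theorem edgeSetoid_map_le_iff {f : V → W} {E : List (V × V)} {r : Setoid W} :
    edgeSetoid (E.map (Prod.map f f)) ≤ r ↔ edgeSetoid E ≤ r.comap f := by
  simp only [edgeSetoid_le_iff, List.forall_mem_map]
  rfl

/-- The number of edges that start in `B`; the sets `B` of interest are unions of connected
components, so that these are the edges in `B`. -/
def edgeCount (E : List (V × V)) (B : Set V) : ℕ := (E.map fun e => B.indicator 1 e.1).sum

@[simp]
theorem edgeCount_nil (B : Set V) : edgeCount [] B = 0 := rfl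

@[simp]
theorem edgeCount_cons (e : V × V) (E : List (V × V)) (B : Set V) :
    edgeCount (e :: E) B = B.indicator 1 e.1 + edgeCount E B := by
  simp [edgeCount]

theorem edgeCount_append (E E' : List (V × V)) (B : Set V) :
    edgeCount (E ++ E') B = edgeCount E B + edgeCount E' B := by
  simp [edgeCount]

theorem edgeCount_map (f : V → W) (E : List (V × V)) (B : Set W) :
    edgeCount (E.map (Prod.map f f)) B = edgeCount E (f ⁻¹' B) := by
  simp only [edgeCount, List.map_map]
  rfl

theorem edgeCount_univ (E : List (V × V)) : edgeCount E Set.univ = E.length := by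
  induction E with
  | nil => rfl
  | cons e E ih => simp [ih, add_comm]

variable {A : Type*} [Ring A] [Algebra ℚ A] {d : ℕ} (F : GradedFrobenius A d)

/-- The product of the classes of the diagonals given by the edges of a multigraph. -/
def edgeProd (E : List (V × V)) : F.Tensor V := (E.map fun e => F.diag e.1 e.2).prod

theorem edgeProd_cons (e : V × V) (E : List (V × V)) :
    F.edgeProd (e :: E) = F.diag e.1 e.2 * F.edgeProd E := by
  simp [edgeProd]

theorem edgeProd_append (E E' : List (V × V)) :
    F.edgeProd (E ++ E') = F.edgeProd E * F.edgeProd E' := by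
  simp [edgeProd]

theorem edgeProd_commute (E : List (V × V)) (x : F.Tensor V) : Commute (F.edgeProd E) x := by
  refine Commute.list_prod_left _ _ fun y hy => ?_
  obtain ⟨e, -, rfl⟩ := List.mem_map.1 hy
  exact F.diag_commute _ _ _

theorem pull_edgeProd (φ : V → W) (E : List (V × V)) :
    F.pull φ (F.edgeProd E) = F.edgeProd (E.map (Prod.map φ φ)) := by
  simp [edgeProd, map_list_prod, pull_diag, Function.comp_def]

theorem edgeProd_mul_mem_tensorGr [Finite V] (E : List (V × V)) {p : ℤ} {x : F.Tensor V}
    (hx : x ∈ F.tensorGr V p) : F.edgeProd E * x ∈ F.tensorGr V (p + 2 * E.length * d) := by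
  induction E with
  | nil => simpa [edgeProd] using hx
  | cons e E ih =>
    rw [edgeProd_cons, mul_assoc (F.diag _ _)]
    convert F.mul_mem_tensorGr (F.diag_mem_tensorGr e.1 e.2) ih using 1
    rw [List.length_cons]
    push_cast
    ring_nf

/-- The product over the edges of a multigraph with vertex set `I` only depends on the map
`φ : I → J` to the set of connected components and on the first Betti numbers `b` of the
components: it is `φ_* e^b`. The first edge `(i, i')` is contracted: if it is a loop then it
contributes the factor `e`; else it contributes `χ_* 1`, where `χ` identifies `i` and `i'`. -/
theorem exists_edgeProd_eq_push {J : Type*} [Finite J] (N : ℕ) :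
    ∀ (I : Type u) [Finite I] (E : List (I × I)), E.length = N → ∀ φ : I → J,
      Function.Surjective φ → Setoid.ker φ = edgeSetoid E →
      ∃ b : J → ℕ, (∀ j, b j + Nat.card {x // φ x = j} = edgeCount E (φ ⁻¹' {j}) + 1) ∧
        F.edgeProd E = F.push φ (F.eulerPow b) := by
  classical
  induction N with
  | zero =>
    intro I _ E hE φ hφ hker
    obtain rfl := List.length_eq_zero_iff.1 hE
    have hinj : Function.Injective φ := by
      rw [Setoid.injective_iff_ker_bot, hker, edgeSetoid_nil]
    refine ⟨0, fun j => ?_, ?_⟩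
    · have : Nat.card {x // φ x = j} = 1 := by
        obtain ⟨i, rfl⟩ := hφ j
        rw [Nat.card_eq_one_iff_unique]
        exact ⟨⟨fun x y => Subtype.ext (hinj (x.2.trans y.2.symm))⟩, ⟨⟨i, rfl⟩⟩⟩
      simp [this]
    · rw [eulerPow_zero, F.push_one_of_bijective ⟨hinj, hφ⟩]
      simp [edgeProd]
  | succ N ih =>
    intro I _ E hE φ hφ hker
    obtain _ | ⟨⟨i, i'⟩, E⟩ := E
    · simp at hE
    replace hE : E.length = N := by simpa using hE
    have hφi : φ i = φ i' := by
      have : Setoid.ker φ i i' := by rw [hker]; exact edgeSetoid_rel (e := (i, i')) (by simp)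
      exact this
    have hedge : ∀ e ∈ E, φ e.1 = φ e.2 := fun e he => by
      have : Setoid.ker φ e.1 e.2 := by rw [hker]; exact edgeSetoid_rel (by simp [he])
      exact this
    by_cases hi : i = i'
    · subst hi
      obtain ⟨b, hb, hprod⟩ := ih I E hE φ hφ (by
        rw [hker, edgeSetoid_cons, sup_eq_right, edgeSetoid_le_iff]
        simp only [List.mem_singleton, forall_eq]
        exact Setoid.refl' _ i)
      refine ⟨b + Pi.single (φ i) 1, fun j => ?_, ?_⟩
      · have := hb j
        by_cases hj : j = φ i
        · subst hj
          simp
          omega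
        · have hj' : φ i ≠ j := fun h => hj h.symm
          simp [hj, hj']
          omega
      · rw [edgeProd_cons, (F.diag_commute _ _ _).eq, hprod, diag_self, ← push_mul_pull, pull_incl,
          eulerPow_add_single]
    · let χ : I → {x : I // x ≠ i'} := fun x => if h : x = i' then ⟨i, hi⟩ else ⟨x, h⟩
      have hχ : ∀ x (h : x ≠ i'), χ x = ⟨x, h⟩ := fun x h => by simp [χ, h]
      have hχi' : χ i' = ⟨i, hi⟩ := by simp [χ]
      have hφχ : ∀ x, φ (χ x).1 = φ x := fun x => by
        by_cases h : x = i'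
        · rw [h, hχi', hφi]
        · rw [hχ x h]
      have hχs : Function.Surjective χ := fun x => ⟨x.1, hχ x.1 x.2⟩
      have hle : Setoid.ker φ ≤ (edgeSetoid (E.map (Prod.map χ χ))).comap χ := by
        rw [hker, edgeSetoid_cons, sup_le_iff, ← edgeSetoid_map_le_iff (E := E),
          edgeSetoid_le_iff]
        refine ⟨?_, le_rfl⟩
        simp only [List.mem_singleton, forall_eq, Setoid.comap_rel, hχi', hχ i hi]
        exact Setoid.refl' _ _
      obtain ⟨b, hb, hprod⟩ := ih _ (E.map (Prod.map χ χ)) (by simpa using hE)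
        (fun x => φ x.1) (fun j => by
          obtain ⟨x, rfl⟩ := hφ j
          exact ⟨χ x, hφχ x⟩) (by
          refine le_antisymm (fun x y hxy => ?_) ?_
          · have := hle (x := x.1) (y := y.1) hxy
            rwa [Setoid.comap_rel, hχ _ x.2, hχ _ y.2] at this
          · rw [edgeSetoid_map_le_iff, edgeSetoid_le_iff]
            intro e he
            change φ (χ e.1).1 = φ (χ e.2).1
            rw [hφχ, hφχ, hedge e he])
      refine ⟨b, fun j => ?_, ?_⟩
      · have h1 := hb j
        have h2 : (fun x : {x : I // x ≠ i'} => φ x.1) ∘ χ = φ := funext hφχ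
        rw [edgeCount_map, ← Set.preimage_comp, h2] at h1
        have h3 : Nat.card {x : I // φ x = j} =
            Nat.card {x : {x : I // x ≠ i'} // φ x.1 = j} + (φ ⁻¹' {j}).indicator 1 i := by
          have h4 : Nat.card {x : {x : I // x ≠ i'} // φ x.1 = j} =
              Set.ncard ({x : I | φ x = j} \ {i'}) := by
            rw [← Nat.card_coe_set_eq]
            exact Nat.card_congr ⟨fun x => ⟨x.1.1, x.2, x.1.2⟩, fun x => ⟨⟨x.1, x.2.2⟩, x.2.1⟩,
              fun _ => rfl, fun _ => rfl⟩
          rw [h4]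
          change Set.ncard {x : I | φ x = j} = _
          by_cases hj : φ i = j
          · have : i' ∈ {x : I | φ x = j} := by simp [← hφi, hj]
            rw [← Set.ncard_sdiff_singleton_add_one this]
            simp [hj]
          · have : i' ∉ {x : I | φ x = j} := by simp [← hφi, hj]
            rw [Set.sdiff_singleton_eq_self this]
            simp [hj]
        rw [h3, edgeCount_cons]
        dsimp only
        omega
      · have h1 := F.push_one_of_merge hχs hi (by rw [hχi', hχ i hi]) fun x y hx hy h => by
          rw [hχ x hx, hχ y hy] at h
          exact congrArg Subtype.val h
        rw [edgeProd_cons, ← h1, ← push_mul_pull, one_mul, pull_edgeProd, hprod, push_push]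
        exact congrArg (fun f => F.push f _) (funext hφχ)

/-- The set `B` is a union of classes of `s`. -/
def Saturated (s : Setoid V) (B : Set V) : Prop := ∀ x y, s x y → (x ∈ B ↔ y ∈ B)

theorem Saturated.mono {s t : Setoid V} {B : Set V} (h : Saturated t B) (hst : s ≤ t) :
    Saturated s B :=
  fun x y hxy => h x y (hst hxy)

theorem saturated_preimage (s : Setoid V) (C : Set (Quotient s)) :
    Saturated s (Quotient.mk s ⁻¹' C) := fun x y hxy => by
  rw [Set.mem_preimage, Set.mem_preimage, Quotient.sound hxy]

/-- The number of classes of `s` that meet `B`. -/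
def classCount (s : Setoid V) (B : Set V) : ℕ := (Quotient.mk s '' B).ncard

theorem card_fibre {s t : Setoid V} (h : s ≤ t) (φ : Quotient s → Quotient t)
    (hφ : ∀ v, φ (Quotient.mk s v) = Quotient.mk t v) (j : Quotient t) :
    Nat.card {c // φ c = j} = classCount s (Quotient.mk t ⁻¹' {j}) := by
  change Set.ncard {c | φ c = j} = _
  rw [classCount]
  congr 1
  ext c
  induction c using Quotient.ind with
  | _ v =>
    simp only [Set.mem_ofPred_eq, Set.mem_image, Set.mem_preimage, Set.mem_singleton_iff, hφ]
    constructor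
    · exact fun hv => ⟨v, hv, rfl⟩
    · rintro ⟨w, rfl, hw⟩
      exact (Quotient.sound (h (Quotient.exact hw))).symm

/-- `exists_edgeProd_eq_push` for the graph that `E` induces on the set of classes of `s`; the set
of its connected components is the set of classes of `t = s ⊔ edgeSetoid E`. -/
theorem exists_pull_edgeProd_eq_push {V : Type u} [Finite V] {s t : Setoid V} {E : List (V × V)}
    (h : s ⊔ edgeSetoid E = t) (φ : Quotient s → Quotient t)
    (hφ : ∀ v, φ (Quotient.mk s v) = Quotient.mk t v) :
    ∃ b : Quotient t → ℕ, (∀ j, b j + classCount s (Quotient.mk t ⁻¹' {j}) =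
        edgeCount E (Quotient.mk t ⁻¹' {j}) + 1) ∧
      F.pull (Quotient.mk s) (F.edgeProd E) = F.push φ (F.eulerPow b) := by
  have hst : s ≤ t := h ▸ le_sup_left
  have hEt : edgeSetoid E ≤ t := h ▸ le_sup_right
  obtain ⟨b, hb, hprod⟩ := F.exists_edgeProd_eq_push _ (Quotient s)
    (E.map (Prod.map (Quotient.mk s) (Quotient.mk s))) rfl φ (fun j => by
      induction j using Quotient.ind with
      | _ v => exact ⟨_, hφ v⟩) (by
      refine le_antisymm (fun x y hxy => ?_) ?_
      · induction x using Quotient.ind with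
        | _ x =>
        induction y using Quotient.ind with
        | _ y =>
        rw [Setoid.ker_def, hφ, hφ] at hxy
        have hle : t ≤ (edgeSetoid (E.map (Prod.map (Quotient.mk s) (Quotient.mk s)))).comap
            (Quotient.mk s) := by
          rw [← h, sup_le_iff, ← edgeSetoid_map_le_iff]
          refine ⟨fun x y hxy => ?_, le_rfl⟩
          rw [Setoid.comap_rel, Quotient.sound hxy]
        exact hle (Quotient.exact hxy)
      · rw [edgeSetoid_map_le_iff, edgeSetoid_le_iff]
        intro e he
        rw [Setoid.comap_rel, Setoid.ker_def, hφ, hφ]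
        exact Quotient.sound (edgeSetoid_le_iff.1 hEt e he))
  refine ⟨b, fun j => ?_, ?_⟩
  · have := hb j
    rwa [card_fibre hst φ hφ, edgeCount_map, ← Set.preimage_comp,
      show φ ∘ Quotient.mk s = Quotient.mk t from funext hφ] at this
  · rw [pull_edgeProd, hprod]

/-- The class of `E` in `A^{⊗ V/s}` only depends on the components of the graph induced on `V/s`
and on the number of edges in each of them. -/
theorem pull_edgeProd_congr {V : Type u} [Finite V] {s : Setoid V} {E E' : List (V × V)}
    (h : s ⊔ edgeSetoid E = s ⊔ edgeSetoid E')
    (hcount : ∀ B : Set V, Saturated (s ⊔ edgeSetoid E) B → edgeCount E B = edgeCount E' B) :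
    F.pull (Quotient.mk s) (F.edgeProd E) = F.pull (Quotient.mk s) (F.edgeProd E') := by
  let φ : Quotient s → Quotient (s ⊔ edgeSetoid E) := Setoid.map_of_le le_sup_left
  obtain ⟨b, hb, hprod⟩ := F.exists_pull_edgeProd_eq_push rfl φ fun v => rfl
  obtain ⟨b', hb', hprod'⟩ := F.exists_pull_edgeProd_eq_push h.symm φ fun v => rfl
  rw [hprod, hprod']
  congr 2
  funext j
  have h1 := hb j
  have h2 := hb' j
  rw [hcount _ (saturated_preimage _ _)] at h1
  omega

end Graph

/-! ### Orbits of permutations and transpositions -/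

section Orbit

open Equiv

variable {V W : Type*}

/-- The partition of `V` into the orbits of `π`. -/
abbrev permSetoid (π : Perm V) : Setoid V := MulAction.orbitRel (Subgroup.zpowers π) V

theorem orbitRel_closure_le_iff {S : Set (Perm V)} {r : Setoid V} :
    MulAction.orbitRel (Subgroup.closure S) V ≤ r ↔ ∀ g ∈ S, ∀ x, r (g x) x := by
  constructor
  · exact fun h g hg x => h ⟨⟨g, Subgroup.subset_closure hg⟩, rfl⟩
  · rintro h x y ⟨⟨g, hg⟩, rfl⟩
    suffices ∀ x, r (g x) x from this y
    induction hg using Subgroup.closure_induction with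
    | mem g hg => exact h g hg
    | one => exact r.refl'
    | mul g k _ _ hg hk => exact fun x => r.trans' (hg (k x)) (hk x)
    | inv g _ hg => exact fun x => by simpa using r.symm' (hg (g⁻¹ x))

theorem permSetoid_le_iff {π : Perm V} {r : Setoid V} :
    permSetoid π ≤ r ↔ ∀ x, r (π x) x := by
  rw [permSetoid, Subgroup.zpowers_eq_closure, orbitRel_closure_le_iff]
  simp

theorem permSetoid_apply (π : Perm V) (x : V) : permSetoid π (π x) x :=
  permSetoid_le_iff.1 le_rfl x

theorem permSetoid_iff {π : Perm V} {x y : V} : permSetoid π x y ↔ π.SameCycle x y := by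
  rw [Perm.sameCycle_comm]
  constructor
  · rintro ⟨⟨_, k, rfl⟩, h⟩
    exact ⟨k, h⟩
  · rintro ⟨k, h⟩
    exact ⟨⟨_, k, rfl⟩, h⟩

theorem permSetoid_one : permSetoid (1 : Perm V) = ⊥ :=
  le_bot_iff.1 (permSetoid_le_iff.2 fun x => Setoid.refl' _ x)

theorem orbitRel_pairGroup {n : ℕ} (π ρ : Perm (Fin n)) :
    MulAction.orbitRel (pairGroup π ρ) (Fin n) = permSetoid π ⊔ permSetoid ρ :=
  eq_of_forall_ge_iff fun r => by
    simp [orbitRel_closure_le_iff, permSetoid_le_iff]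

theorem permSetoid_mul_le (π ρ : Perm V) : permSetoid (π * ρ) ≤ permSetoid π ⊔ permSetoid ρ :=
  permSetoid_le_iff.2 fun x => Setoid.trans' _
    ((le_sup_left : permSetoid π ≤ _) (permSetoid_apply π (ρ x)))
    ((le_sup_right : permSetoid ρ ≤ _) (permSetoid_apply ρ x))

theorem pow_apply_eq_pow_mod_apply {g : Perm V} {m : ℕ} {x : V} (h : (g ^ m) x = x) (k : ℕ) :
    (g ^ k) x = (g ^ (k % m)) x := by
  conv_lhs => rw [← Nat.mod_add_div k m, pow_add, pow_mul, Perm.mul_apply,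
    Perm.pow_apply_eq_self_of_apply_eq_self h]

/-- Multiplication by the transposition `(i j)` either splits the orbit of `i` and `j` or merges
their orbits. -/
theorem sameCycle_mul_swap_iff [Finite V] [DecidableEq V] (π : Perm V) {i j : V} (hij : i ≠ j) :
    (π * swap i j).SameCycle i j ↔ ¬ π.SameCycle i j := by
  set π' := π * swap i j
  -- the first time that the orbit of `j` under `π` meets `{i, j}` again
  have hex : ∃ m, 0 < m ∧ ((π ^ m) j = i ∨ (π ^ m) j = j) :=
    ⟨orderOf π, orderOf_pos π, Or.inr (by rw [pow_orderOf_eq_one]; rfl)⟩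
  obtain ⟨hm0, hm⟩ := Nat.find_spec hex
  have hmin : ∀ t, 0 < t → t < Nat.find hex → (π ^ t) j ≠ i ∧ (π ^ t) j ≠ j := fun t h0 ht => by
    have := Nat.find_min hex ht
    tauto
  set m := Nat.find hex
  have hpow : ∀ t, 0 < t → t ≤ m → (π' ^ t) i = (π ^ t) j := by
    intro t h0 ht
    induction t with
    | zero => omega
    | succ t ih =>
      rw [pow_succ', pow_succ' π]
      change π (swap i j ((π' ^ t) i)) = π ((π ^ t) j)
      rcases Nat.eq_zero_or_pos t with rfl | h
      · simp
      · obtain ⟨h1, h2⟩ := hmin t h (by omega)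
        rw [ih h (by omega), swap_apply_of_ne_of_ne h1 h2]
  have hmod : ∀ k, k % m < m := fun k => Nat.mod_lt _ hm0
  rcases hm with hm | hm
  · have h1 : π.SameCycle i j := Perm.SameCycle.symm ⟨m, by simpa using hm⟩
    have h2 : ¬ π'.SameCycle i j := fun h => by
      obtain ⟨k, hk⟩ := h.exists_nat_pow_eq
      rw [pow_apply_eq_pow_mod_apply ((hpow m hm0 le_rfl).trans hm)] at hk
      rcases Nat.eq_zero_or_pos (k % m) with h | h
      · rw [h] at hk
        exact hij hk
      · rw [hpow _ h (hmod k).le] at hk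
        exact (hmin _ h (hmod k)).2 hk
    tauto
  · have h1 : π'.SameCycle i j := ⟨m, by simpa using (hpow m hm0 le_rfl).trans hm⟩
    have h2 : ¬ π.SameCycle i j := fun h => by
      obtain ⟨k, hk⟩ := h.symm.exists_nat_pow_eq
      rw [pow_apply_eq_pow_mod_apply hm] at hk
      rcases Nat.eq_zero_or_pos (k % m) with h | h
      · rw [h] at hk
        exact hij hk.symm
      · exact (hmin _ h (hmod k)).1 hk
    tauto

/-- Joining two classes of a partition lowers the number of classes by one. -/
theorem classCount_eq_add [Finite V] {s : Setoid V} {i j : V} (hij : ¬ s i j) {B : Set V}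
    (hB : Saturated (s ⊔ edgeSetoid [(i, j)]) B) :
    classCount s B = classCount (s ⊔ edgeSetoid [(i, j)]) B + B.indicator 1 i := by
  classical
  set t := s ⊔ edgeSetoid [(i, j)] with ht
  have hst : s ≤ t := le_sup_left
  have htij : t i j := (le_sup_right : _ ≤ t) (edgeSetoid_rel (e := (i, j)) (by simp))
  have hne : Quotient.mk s i ≠ Quotient.mk s j := fun h => hij (Quotient.exact h)
  -- the map that identifies the two classes and fixes the others
  let f : Quotient s → Quotient s := Function.update id (Quotient.mk s j) (Quotient.mk s i)
  have hfj : f (Quotient.mk s j) = Quotient.mk s i := by simp [f]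
  have hf : ∀ c, c ≠ Quotient.mk s j → f c = c := fun c hc => by simp [f, hc]
  have hker : Setoid.ker (fun v => f (Quotient.mk s v)) = t := by
    refine le_antisymm (fun x y hxy => ?_) ?_
    · have hex : ∀ x, ∃ x', f (Quotient.mk s x) = Quotient.mk s x' ∧ t x x' := fun x => by
        by_cases hx : Quotient.mk s x = Quotient.mk s j
        · exact ⟨i, by rw [hx, hfj], t.trans' (hst (Quotient.exact hx)) (t.symm' htij)⟩
        · exact ⟨x, hf _ hx, t.refl' x⟩
      obtain ⟨x', hx', htx⟩ := hex x
      obtain ⟨y', hy', hty⟩ := hex y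
      rw [Setoid.ker_def, hx', hy'] at hxy
      exact t.trans' htx (t.trans' (hst (Quotient.exact hxy)) (t.symm' hty))
    · rw [ht, sup_le_iff, edgeSetoid_le_iff]
      refine ⟨fun x y hxy => ?_, ?_⟩
      · rw [Setoid.ker_def, Quotient.sound hxy]
      · simp only [List.mem_singleton, forall_eq]
        rw [Setoid.ker_def, hfj, hf _ hne]
  have hcount : classCount t B = (f '' (Quotient.mk s '' B)).ncard := by
    rw [← hker, classCount, ← Set.ncard_image_of_injective _ (Setoid.kerLift_injective _),
      Set.image_image, Set.image_image]
    rfl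
  rw [hcount, classCount]
  by_cases hi : i ∈ B
  · have hj : Quotient.mk s j ∈ Quotient.mk s '' B := ⟨j, (hB i j htij).1 hi, rfl⟩
    have himage : f '' (Quotient.mk s '' B) = (Quotient.mk s '' B) \ {Quotient.mk s j} := by
      ext c
      simp only [Set.mem_image, Set.mem_sdiff, Set.mem_singleton_iff, exists_exists_and_eq_and]
      constructor
      · rintro ⟨x, hx, rfl⟩
        by_cases h : Quotient.mk s x = Quotient.mk s j
        · rw [h, hfj]
          exact ⟨⟨i, hi, rfl⟩, hne⟩
        · rw [hf _ h]
          exact ⟨⟨x, hx, rfl⟩, h⟩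
      · rintro ⟨⟨x, hx, rfl⟩, h⟩
        exact ⟨x, hx, hf _ h⟩
    rw [himage, Set.indicator_of_mem hi, Pi.one_apply, Set.ncard_sdiff_singleton_add_one hj]
  · rw [Set.indicator_of_notMem hi, add_zero]
    congr 1
    have hj : ∀ c ∈ Quotient.mk s '' B, f c = c := by
      rintro _ ⟨x, hx, rfl⟩
      refine hf _ fun h => hi ((hB i x ?_).2 hx)
      exact t.trans' htij (t.symm' (hst (Quotient.exact h)))
    rw [Set.image_congr hj, Set.image_id']

theorem permSetoid_mul_swap_sup [DecidableEq V] (π : Perm V) (i j : V) :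
    permSetoid (π * swap i j) ⊔ edgeSetoid [(i, j)] = permSetoid π ⊔ edgeSetoid [(i, j)] := by
  have key : ∀ π : Perm V, permSetoid (π * swap i j) ≤ permSetoid π ⊔ edgeSetoid [(i, j)] := by
    intro π
    set t := permSetoid π ⊔ edgeSetoid [(i, j)]
    have htij : t i j := (le_sup_right : _ ≤ t) (edgeSetoid_rel (e := (i, j)) (by simp))
    refine permSetoid_le_iff.2 fun x =>
      t.trans' ((le_sup_left : _ ≤ t) (permSetoid_apply π (swap i j x))) ?_
    rw [swap_apply_def]
    split_ifs with hi hj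
    · rw [hi]; exact t.symm' htij
    · rw [hj]; exact htij
    · exact t.refl' x
  refine le_antisymm (sup_le (key π) le_sup_right) (sup_le ?_ le_sup_right)
  simpa [mul_assoc] using key (π * swap i j)

/-- The effect of multiplication by a transposition that splits an orbit. -/
theorem permSetoid_mul_swap_of_rel [Finite V] [DecidableEq V] {π : Perm V} {i j : V} (hij : i ≠ j)
    (h : permSetoid π i j) :
    permSetoid (π * swap i j) ⊔ edgeSetoid [(i, j)] = permSetoid π ∧
      ∀ B, Saturated (permSetoid π) B → classCount (permSetoid (π * swap i j)) B =
        classCount (permSetoid π) B + B.indicator 1 i := by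
  have h1 : permSetoid (π * swap i j) ⊔ edgeSetoid [(i, j)] = permSetoid π := by
    rw [permSetoid_mul_swap_sup, sup_eq_left, edgeSetoid_le_iff]
    simpa using h
  refine ⟨h1, fun B hB => ?_⟩
  have h2 : ¬ permSetoid (π * swap i j) i j := by
    rw [permSetoid_iff, sameCycle_mul_swap_iff π hij, not_not]
    exact permSetoid_iff.1 h
  rw [classCount_eq_add h2 (h1.symm ▸ hB), h1]

/-- The effect of multiplication by a transposition that merges two orbits. -/
theorem permSetoid_mul_swap_of_not_rel [Finite V] [DecidableEq V] {π : Perm V} {i j : V}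
    (hij : i ≠ j) (h : ¬ permSetoid π i j) :
    permSetoid (π * swap i j) = permSetoid π ⊔ edgeSetoid [(i, j)] ∧
      ∀ B, Saturated (permSetoid (π * swap i j)) B → classCount (permSetoid π) B =
        classCount (permSetoid (π * swap i j)) B + B.indicator 1 i := by
  have h2 : permSetoid (π * swap i j) i j := by
    rw [permSetoid_iff, sameCycle_mul_swap_iff π hij]
    exact fun h' => h (permSetoid_iff.2 h')
  have h1 : permSetoid (π * swap i j) = permSetoid π ⊔ edgeSetoid [(i, j)] := by
    rw [← permSetoid_mul_swap_sup, left_eq_sup, edgeSetoid_le_iff]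
    simpa using h2
  refine ⟨h1, fun B hB => ?_⟩
  rw [h1] at hB ⊢
  exact classCount_eq_add h hB

/-- The product of the transpositions given by a list of pairs. -/
def swapProd [DecidableEq V] (T : List (V × V)) : Perm V := (T.map fun e => swap e.1 e.2).prod

/-- A minimal factorization of `ρ` into transpositions; as a graph, it is a forest whose trees span
the orbits of `ρ`. -/
theorem exists_swapProd_eq [Finite V] [DecidableEq V] (ρ : Perm V) :
    ∃ T : List (V × V), (∀ e ∈ T, e.1 ≠ e.2) ∧ swapProd T = ρ ∧ edgeSetoid T = permSetoid ρ ∧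
      ∀ B, Saturated (permSetoid ρ) B → edgeCount T B + classCount (permSetoid ρ) B = B.ncard := by
  induction h : Nat.card V - classCount (permSetoid ρ) Set.univ using Nat.strong_induction_on
    generalizing ρ with
  | _ N ih =>
    by_cases hρ : ρ = 1
    · subst hρ
      refine ⟨[], by simp, rfl, by rw [edgeSetoid_nil, permSetoid_one], fun B _ => ?_⟩
      rw [edgeCount_nil, zero_add, classCount, Set.ncard_image_of_injective]
      intro x y hxy
      have := Quotient.exact hxy
      rw [← Quotient.eq_iff_equiv, Quotient.eq, permSetoid_iff, Perm.sameCycle_one] at this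
      exact this
    · -- a transposition that splits an orbit of `ρ` raises the number of orbits
      obtain ⟨i, hi⟩ : ∃ i, ρ i ≠ i := by
        by_contra! h
        exact hρ (Perm.ext h)
      obtain ⟨hsup, hcount⟩ := permSetoid_mul_swap_of_rel (π := ρ) (i := i) (j := ρ i) hi.symm
        (Setoid.symm' _ (permSetoid_apply ρ i))
      have huniv := hcount Set.univ fun x y _ => by simp
      have hle : classCount (permSetoid (ρ * swap i (ρ i))) Set.univ ≤ Nat.card V := by
        rw [← Set.ncard_univ]
        exact Set.ncard_image_le
      simp only [Set.indicator_univ, Pi.one_apply] at huniv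
      obtain ⟨T, hT, hprod, hT', hTcount⟩ := ih _ (by omega) (ρ * swap i (ρ i)) rfl
      refine ⟨T ++ [(i, ρ i)], ?_, ?_, ?_, fun B hB => ?_⟩
      · intro e he
        rcases List.mem_append.1 he with he | he
        · exact hT e he
        · rw [List.mem_singleton.1 he]
          exact hi.symm
      · simp only [swapProd, List.map_append, List.prod_append] at hprod ⊢
        rw [hprod]
        simp [mul_assoc]
      · rw [edgeSetoid_append, hT', hsup]
      · have h1 := hTcount B (hB.mono (hsup ▸ le_sup_left))
        have h2 := hcount B hB
        rw [edgeCount_append, edgeCount_cons, edgeCount_nil]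
        dsimp only
        omega

/-- If the transpositions in `T` are multiplied onto `π` one after the other, then those that split
an orbit form a list `E` of edges which, on the set of orbits of the product, has the orbits of `π`
and all transpositions in `T` as its connected components. -/
theorem exists_splitting_edges [Finite V] [DecidableEq V] (T : List (V × V))
    (hT : ∀ e ∈ T, e.1 ≠ e.2) (π : Perm V) :
    ∃ E : List (V × V), permSetoid (π * swapProd T) ⊔ edgeSetoid E = permSetoid π ⊔ edgeSetoid T ∧
      ∀ B, Saturated (permSetoid π ⊔ edgeSetoid T) B →
        2 * edgeCount E B + classCount (permSetoid π) B =
          edgeCount T B + classCount (permSetoid (π * swapProd T)) B := by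
  induction T generalizing π with
  | nil => exact ⟨[], by simp [swapProd], fun B _ => by simp [swapProd]⟩
  | cons e T ih =>
    obtain ⟨i, j⟩ := e
    have hij : i ≠ j := hT (i, j) (by simp)
    obtain ⟨E, hE, hcount⟩ := ih (fun e he => hT e (by simp [he])) (π * swap i j)
    have hprod : π * swapProd ((i, j) :: T) = π * swap i j * swapProd T := by
      simp [swapProd, mul_assoc]
    have hsup : permSetoid (π * swap i j) ⊔ edgeSetoid T ≤
        permSetoid π ⊔ edgeSetoid ((i, j) :: T) := by
      rw [edgeSetoid_cons, ← sup_assoc, ← permSetoid_mul_swap_sup]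
      exact sup_le_sup_right le_sup_left _
    by_cases h : permSetoid π i j
    · obtain ⟨h1, h2⟩ := permSetoid_mul_swap_of_rel hij h
      refine ⟨(i, j) :: E, ?_, fun B hB => ?_⟩
      · have h3 : permSetoid π ⊔ edgeSetoid [(i, j)] = permSetoid π :=
          sup_eq_left.2 (h1 ▸ le_sup_right)
        rw [hprod, edgeSetoid_cons, sup_left_comm, hE, edgeSetoid_cons _ T, sup_left_comm,
          ← sup_assoc, h1, ← sup_assoc, h3]
      · have h3 := hcount B (hB.mono hsup)
        have h4 := h2 B (hB.mono le_sup_left)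
        rw [hprod, edgeCount_cons, edgeCount_cons]
        dsimp only
        omega
    · obtain ⟨h1, h2⟩ := permSetoid_mul_swap_of_not_rel hij h
      refine ⟨E, ?_, fun B hB => ?_⟩
      · rw [hprod, hE, edgeSetoid_cons _ T, ← sup_assoc, h1]
      · have h3 := hcount B (hB.mono hsup)
        have h4 := h2 B (hB.mono (le_sup_left.trans hsup))
        rw [hprod, edgeCount_cons]
        dsimp only
        omega

/-- A list `E` of edges such that the graph it induces on the set of orbits of `π ρ` has the
orbits of `⟨π, ρ⟩` as its connected components, with the graph defects of `π` and `ρ` as first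
Betti numbers. -/
structure IsDefectGraph (π ρ : Perm V) (E : List (V × V)) : Prop where
  sup_eq : permSetoid (π * ρ) ⊔ edgeSetoid E = permSetoid π ⊔ permSetoid ρ
  count_eq : ∀ B, Saturated (permSetoid π ⊔ permSetoid ρ) B →
    2 * edgeCount E B + classCount (permSetoid π) B + classCount (permSetoid ρ) B =
      B.ncard + classCount (permSetoid (π * ρ)) B

theorem exists_isDefectGraph [Finite V] (π ρ : Perm V) : ∃ E, IsDefectGraph π ρ E := by
  classical
  obtain ⟨T, hT, rfl, hsup, hcount⟩ := exists_swapProd_eq ρ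
  obtain ⟨E, hE, hE'⟩ := exists_splitting_edges T hT π
  rw [hsup] at hE hE'
  refine ⟨E, hE, fun B hB => ?_⟩
  have h1 := hE' B hB
  have h2 := hcount B (hB.mono le_sup_right)
  omega

theorem permSetoid_conj_le_iff {σ π : Perm V} {r : Setoid V} :
    permSetoid (σ * π * σ⁻¹) ≤ r ↔ permSetoid π ≤ r.comap σ := by
  rw [permSetoid_le_iff, permSetoid_le_iff, ← σ.forall_congr_right]
  simp [Setoid.comap_rel]

theorem comap_permSetoid_conj (σ π : Perm V) :
    (permSetoid (σ * π * σ⁻¹)).comap σ = permSetoid π := by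
  refine le_antisymm (fun x y hxy => ?_) (permSetoid_conj_le_iff.1 le_rfl)
  have : permSetoid (σ * π * σ⁻¹) ≤ (permSetoid π).comap (σ⁻¹ : Perm V) :=
    permSetoid_conj_le_iff.2 fun x y h => by
    simpa [Setoid.comap_rel] using h
  simpa [Setoid.comap_rel] using this hxy

theorem classCount_comap (σ : V ≃ W) (s : Setoid W) (B : Set W) :
    classCount (s.comap σ) (σ ⁻¹' B) = classCount s B := by
  let f : Quotient (s.comap σ) → Quotient s := Quotient.map' σ fun x y h => h
  have hf : Function.Injective f := fun x y => by
    induction x using Quotient.ind with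
    | _ x =>
    induction y using Quotient.ind with
    | _ y => exact fun h => Quotient.sound (Quotient.exact h : s (σ x) (σ y))
  rw [classCount, ← Set.ncard_image_of_injective _ hf, classCount, Set.image_image]
  congr 1
  ext c
  constructor
  · rintro ⟨x, hx, rfl⟩
    exact ⟨σ x, hx, rfl⟩
  · rintro ⟨x, hx, rfl⟩
    refine ⟨σ.symm x, by simpa using hx, ?_⟩
    change Quotient.mk s (σ (σ.symm x)) = _
    rw [apply_symm_apply]

theorem classCount_permSetoid_conj (σ π : Perm V) (B : Set V) :
    classCount (permSetoid (σ * π * σ⁻¹)) B = classCount (permSetoid π) (σ ⁻¹' B) := by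
  rw [← classCount_comap σ, comap_permSetoid_conj]

theorem IsDefectGraph.conj {π ρ : Perm V} {E : List (V × V)} (h : IsDefectGraph π ρ E)
    (σ : Perm V) :
    IsDefectGraph (σ * π * σ⁻¹) (σ * ρ * σ⁻¹) (E.map (Prod.map σ σ)) := by
  have hmul : σ * π * σ⁻¹ * (σ * ρ * σ⁻¹) = σ * (π * ρ) * σ⁻¹ := by group
  refine ⟨?_, fun B hB => ?_⟩
  · rw [hmul]
    refine eq_of_forall_ge_iff fun r => ?_
    rw [sup_le_iff, sup_le_iff, permSetoid_conj_le_iff, permSetoid_conj_le_iff,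
      permSetoid_conj_le_iff, edgeSetoid_map_le_iff, ← sup_le_iff, h.sup_eq, sup_le_iff]
  · have hB' : Saturated (permSetoid π ⊔ permSetoid ρ) (σ ⁻¹' B) := by
      have : permSetoid π ⊔ permSetoid ρ ≤
          (permSetoid (σ * π * σ⁻¹) ⊔ permSetoid (σ * ρ * σ⁻¹)).comap σ :=
        sup_le (permSetoid_conj_le_iff.1 le_sup_left) (permSetoid_conj_le_iff.1 le_sup_right)
      exact fun x y hxy => hB _ _ (this hxy)
    have hcard : (σ ⁻¹' B).ncard = B.ncard :=
      Set.ncard_preimage_of_injective_subset_range σ.injective (by simp [σ.surjective.range_eq])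
    rw [hmul, classCount_permSetoid_conj, classCount_permSetoid_conj, classCount_permSetoid_conj,
      edgeCount_map, h.count_eq _ hB', hcard]

end Orbit

/-! ### The product of `A{S_n}` -/

section Product

open Equiv

variable {A : Type*} [Ring A] [Algebra ℚ A] {d : ℕ} (F : GradedFrobenius A d) {n : ℕ}

theorem orbitCount_eq_classCount {H K : Subgroup (Perm (Fin n))} (h : H ≤ K) (B : Orbits K) :
    orbitCount h B = classCount (MulAction.orbitRel H (Fin n))
      (Quotient.mk (MulAction.orbitRel K (Fin n)) ⁻¹' {B}) := by
  refine card_fibre (fun x y => ?_) (orbitMap h) (fun _ => rfl) B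
  rintro ⟨g, rfl⟩
  exact ⟨⟨g.1, h g.2⟩, rfl⟩

/-- The graph defect is the family of first Betti numbers of a defect graph. -/
theorem exists_graphDefect_eq {π ρ : Perm (Fin n)} {E : List (Fin n × Fin n)}
    (hE : IsDefectGraph π ρ E) :
    ∃ b : Orbits (pairGroup π ρ) → ℕ, (∀ B, graphDefect π ρ B = b B) ∧
      F.pull (Quotient.mk (permSetoid (π * ρ))) (F.edgeProd E) =
        F.push (orbitMap (mul_le π ρ)) (F.eulerPow b) := by
  obtain ⟨b, hb, hprod⟩ := F.exists_pull_edgeProd_eq_push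
    (hE.sup_eq.trans (orbitRel_pairGroup π ρ).symm) (orbitMap (mul_le π ρ)) fun _ => rfl
  refine ⟨b, fun B => ?_, hprod⟩
  set B' : Set (Fin n) := Quotient.mk (MulAction.orbitRel (pairGroup π ρ) (Fin n)) ⁻¹' {B} with hB'
  have h1 := hb B
  have h2 := hE.count_eq B' (orbitRel_pairGroup π ρ ▸ saturated_preimage _ _)
  have hcard : Nat.card B.orbit = B'.ncard := by
    rw [Nat.card_coe_set_eq]
    congr 1
    ext x
    exact MulAction.orbitRel.Quotient.mem_orbit
  rw [graphDefect, orbitCount_eq_classCount, orbitCount_eq_classCount, orbitCount_eq_classCount,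
    hcard, ← hB', div_eq_iff two_ne_zero]
  rw [← hB'] at h1
  have h1' : (b B : ℚ) + classCount (permSetoid (π * ρ)) B' = edgeCount E B' + 1 := by
    exact_mod_cast h1
  have h2' : (2 : ℚ) * edgeCount E B' + classCount (permSetoid π) B' +
      classCount (permSetoid ρ) B' = B'.ncard + classCount (permSetoid (π * ρ)) B' := by
    exact_mod_cast h2
  linarith

theorem mulPerm_apply (π ρ : Perm (Fin n)) (a : F.Tensor (Orbits (Subgroup.zpowers π)))
    (b : F.Tensor (Orbits (Subgroup.zpowers ρ))) :
    F.mulPerm π ρ a b = F.push (orbitMap (mul_le π ρ))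
      (F.pull (orbitMap (left_le π ρ)) a * F.pull (orbitMap (right_le π ρ)) b *
        F.eulerPow fun B => ⌊graphDefect π ρ B⌋₊) := rfl

theorem pull_orbitMap {H K : Subgroup (Perm (Fin n))} (h : H ≤ K) (x : F.Tensor (Fin n)) :
    F.pull (orbitMap h) (F.pull (Quotient.mk (MulAction.orbitRel H (Fin n))) x) =
      F.pull (Quotient.mk (MulAction.orbitRel K (Fin n))) x :=
  F.pull_pull _ _ x

theorem mulPerm_pull {π ρ : Perm (Fin n)} {E : List (Fin n × Fin n)} (hE : IsDefectGraph π ρ E)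
    (x y : F.Tensor (Fin n)) :
    F.mulPerm π ρ (F.pull (Quotient.mk (permSetoid π)) x)
        (F.pull (Quotient.mk (permSetoid ρ)) y) =
      F.pull (Quotient.mk (permSetoid (π * ρ))) (F.edgeProd E * (x * y)) := by
  obtain ⟨b, hb, hprod⟩ := F.exists_graphDefect_eq hE
  have hfloor : (fun B => ⌊graphDefect π ρ B⌋₊) = b := funext fun B => by
    rw [hb, Nat.floor_natCast]
  rw [mulPerm_apply, pull_orbitMap, pull_orbitMap, hfloor, ← map_mul,
    ← (F.eulerPow_commute b _).eq, ← F.pull_orbitMap (mul_le π ρ), push_mul_pull, ← hprod,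
    ← map_mul (F.pull _)]

/-- The element `x̄ π` of `A{S_n}`, where `x̄` is the image of `x` under the map
`A^{⊗[n]} → A^{⊗⟨π⟩\[n]}` that multiplies the factors in each orbit of `π`. These elements span
`A{S_n}`. -/
def singlePull (π : Perm (Fin n)) (x : F.Tensor (Fin n)) : F.SnAlgebra n :=
  F.single π (F.pull (Quotient.mk (permSetoid π)) x)

variable {F} in
theorem singlePull_induction {P : F.SnAlgebra n → Prop} (h0 : P 0)
    (h : ∀ π x, P (F.singlePull π x)) (hadd : ∀ x y, P x → P y → P (x + y)) (x : F.SnAlgebra n) :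
    P x := by
  induction x using DirectSum.induction_on with
  | zero => exact h0
  | of π a =>
    obtain ⟨x, rfl⟩ := F.pull_surjective (Quotient.mk_surjective (s := permSetoid π)) a
    exact h π x
  | add x y hx hy => exact hadd x y hx hy

theorem mulSn_singlePull {π ρ : Perm (Fin n)} {E : List (Fin n × Fin n)}
    (hE : IsDefectGraph π ρ E) (x y : F.Tensor (Fin n)) :
    F.mulSn n (F.singlePull π x) (F.singlePull ρ y) =
      F.singlePull (π * ρ) (F.edgeProd E * (x * y)) := by
  rw [singlePull, singlePull, mulSn_single, F.mulPerm_pull hE, singlePull]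

theorem actSn_singlePull (σ π : Perm (Fin n)) (x : F.Tensor (Fin n)) :
    F.actSn σ (F.singlePull π x) = F.singlePull (σ * π * σ⁻¹) (F.pull σ x) := by
  have : F.actSn σ (F.singlePull π x) = F.single (σ * π * σ⁻¹)
      (F.pull (orbitConj σ π) (F.pull (Quotient.mk (permSetoid π)) x)) := by
    simp [actSn, singlePull, single]
  rw [this, singlePull, pull_pull, pull_pull]
  rfl

/-- Graphs that induce the same components, with the same numbers of edges, on the set of orbits of
`π` are interchangeable in the `π`-part of `A{S_n}`. -/
theorem singlePull_edgeProd_congr {π : Perm (Fin n)} {E E' : List (Fin n × Fin n)}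
    (h : permSetoid π ⊔ edgeSetoid E = permSetoid π ⊔ edgeSetoid E')
    (hcount : ∀ B, Saturated (permSetoid π ⊔ edgeSetoid E) B → edgeCount E B = edgeCount E' B)
    (x : F.Tensor (Fin n)) :
    F.singlePull π (F.edgeProd E * x) = F.singlePull π (F.edgeProd E' * x) := by
  rw [singlePull, singlePull, map_mul (F.pull _), map_mul (F.pull _),
    F.pull_edgeProd_congr h hcount]

theorem mulSn_assoc (x y z : F.SnAlgebra n) :
    F.mulSn n (F.mulSn n x y) z = F.mulSn n x (F.mulSn n y z) := by
  refine singlePull_induction (P := fun x => F.mulSn n (F.mulSn n x y) z =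
    F.mulSn n x (F.mulSn n y z)) (by simp) (fun π x => ?_)
    (fun x x' h h' => by simp only [map_add, LinearMap.add_apply, h, h']) x
  refine singlePull_induction (P := fun y => F.mulSn n (F.mulSn n (F.singlePull π x) y) z =
    F.mulSn n (F.singlePull π x) (F.mulSn n y z)) (by simp) (fun ρ y => ?_)
    (fun x x' h h' => by simp only [map_add, LinearMap.add_apply, h, h']) y
  refine singlePull_induction (P := fun z =>
    F.mulSn n (F.mulSn n (F.singlePull π x) (F.singlePull ρ y)) z =
      F.mulSn n (F.singlePull π x) (F.mulSn n (F.singlePull ρ y) z)) (by simp) (fun τ z => ?_)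
    (fun x x' h h' => by simp only [map_add, h, h']) z
  obtain ⟨E₁, h₁⟩ := exists_isDefectGraph π ρ
  obtain ⟨E₂, h₂⟩ := exists_isDefectGraph (π * ρ) τ
  obtain ⟨E₃, h₃⟩ := exists_isDefectGraph ρ τ
  obtain ⟨E₄, h₄⟩ := exists_isDefectGraph π (ρ * τ)
  rw [F.mulSn_singlePull h₁, F.mulSn_singlePull h₂, F.mulSn_singlePull h₃, F.mulSn_singlePull h₄]
  have e₁ : F.edgeProd E₂ * (F.edgeProd E₁ * (x * y) * z) =
      F.edgeProd (E₂ ++ E₁) * (x * y * z) := by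
    simp only [edgeProd_append, mul_assoc]
  have e₂ : F.edgeProd E₄ * (x * (F.edgeProd E₃ * (y * z))) =
      F.edgeProd (E₄ ++ E₃) * (x * y * z) := by
    rw [← mul_assoc x, ← (F.edgeProd_commute E₃ x).eq]
    simp only [edgeProd_append, mul_assoc]
  have s₁ : permSetoid (π * ρ * τ) ⊔ edgeSetoid (E₂ ++ E₁) =
      permSetoid π ⊔ permSetoid ρ ⊔ permSetoid τ := by
    rw [edgeSetoid_append, ← sup_assoc, h₂.sup_eq, sup_right_comm, h₁.sup_eq]
  have s₂ : permSetoid (π * ρ * τ) ⊔ edgeSetoid (E₄ ++ E₃) =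
      permSetoid π ⊔ permSetoid ρ ⊔ permSetoid τ := by
    rw [mul_assoc, edgeSetoid_append, ← sup_assoc, h₄.sup_eq, sup_assoc, h₃.sup_eq, sup_assoc]
  rw [e₁, e₂, ← mul_assoc π]
  refine F.singlePull_edgeProd_congr (s₁.trans s₂.symm) (fun B hB => ?_) _
  rw [s₁] at hB
  -- twice the number of edges in `B` is `2|B| - |⟨π⟩\B| - |⟨ρ⟩\B| - |⟨τ⟩\B| + |⟨πρτ⟩\B|`
  have c₁ := h₁.count_eq B (hB.mono le_sup_left)
  have c₂ := h₂.count_eq B (hB.mono (sup_le_sup_right (permSetoid_mul_le π ρ) _))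
  have c₃ := h₃.count_eq B (hB.mono (sup_le_sup_right le_sup_right _))
  have c₄ := h₄.count_eq B (hB.mono (by
    rw [sup_assoc]; exact sup_le_sup_left (permSetoid_mul_le ρ τ) _))
  rw [← mul_assoc] at c₄
  rw [edgeCount_append, edgeCount_append]
  omega

theorem actSn_mulSn (σ : Perm (Fin n)) (x y : F.SnAlgebra n) :
    F.actSn σ (F.mulSn n x y) = F.mulSn n (F.actSn σ x) (F.actSn σ y) := by
  refine singlePull_induction (P := fun x => F.actSn σ (F.mulSn n x y) =
    F.mulSn n (F.actSn σ x) (F.actSn σ y)) (by simp) (fun π x => ?_)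
    (fun x x' h h' => by simp only [map_add, LinearMap.add_apply, h, h']) x
  refine singlePull_induction (P := fun y => F.actSn σ (F.mulSn n (F.singlePull π x) y) =
    F.mulSn n (F.actSn σ (F.singlePull π x)) (F.actSn σ y)) (by simp) (fun ρ y => ?_)
    (fun x x' h h' => by simp only [map_add, h, h']) y
  obtain ⟨E, hE⟩ := exists_isDefectGraph π ρ
  rw [F.mulSn_singlePull hE, actSn_singlePull, actSn_singlePull, actSn_singlePull,
    F.mulSn_singlePull (hE.conj σ), map_mul, map_mul, pull_edgeProd]
  congr 1
  group

/-! ### Degrees -/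

/-- A homogeneous element of `A^{⊗W}` is the image of a homogeneous element of `A^{⊗V}`: place
the factors of a pure tensor at chosen preimages under `φ`. -/
theorem exists_mem_tensorGr_pull_eq {V W : Type*} [Finite V] [Finite W] {φ : V → W}
    (hφ : Function.Surjective φ) {p : ℤ} {a : F.Tensor W} (ha : a ∈ F.tensorGr W p) :
    ∃ x ∈ F.tensorGr V (p + Nat.card W * d - Nat.card V * d), F.pull φ x = a := by
  refine ⟨F.pull (Function.surjInv hφ) a, F.pull_mem_tensorGr _ ha, ?_⟩
  rw [pull_pull, (Function.rightInverse_surjInv hφ).id]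
  exact congrArg (· a) (F.algHom_ext (f := F.pull id) (g := AlgHom.id ℚ _) fun i a => by simp)

theorem singlePull_mem_grSn {π : Perm (Fin n)} {p : ℤ} {x : F.Tensor (Fin n)}
    (hx : F.pull (Quotient.mk (permSetoid π)) x ∈
      F.tensorGr (Orbits (Subgroup.zpowers π)) p) : F.singlePull π x ∈ F.grSn n p := by
  classical
  rw [grSn, Submodule.mem_iInf]
  intro ρ
  rw [Submodule.mem_comap, singlePull, single, DirectSum.component.of]
  split_ifs with h
  · subst h
    exact hx
  · exact zero_mem _

theorem mulSn_mem_grSn {p q : ℤ} {x y : F.SnAlgebra n} (hx : x ∈ F.grSn n p)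
    (hy : y ∈ F.grSn n q) : F.mulSn n x y ∈ F.grSn n (p + q + n * d) := by
  classical
  have hcomp : ∀ {m : ℤ} {x : F.SnAlgebra n}, x ∈ F.grSn n m → ∀ π,
      ∃ x' ∈ F.tensorGr (Fin n)
        (m + Nat.card (Orbits (Subgroup.zpowers π)) * d - n * d),
        F.single π (x π) = F.singlePull π x' := fun {m x} hx π => by
    obtain ⟨x', hx', h⟩ := F.exists_mem_tensorGr_pull_eq
      (Quotient.mk_surjective (s := permSetoid π)) ((Submodule.mem_iInf _).1 hx π)
    rw [Nat.card_fin] at hx'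
    exact ⟨x', hx', by rw [singlePull, h]; rfl⟩
  have hsum : ∀ x : F.SnAlgebra n, x = ∑ π, F.single π (x π) := fun x =>
    (DirectSum.sum_univ_of x).symm
  rw [hsum x, hsum y, map_sum (F.mulSn n), LinearMap.sum_apply]
  refine sum_mem fun π _ => ?_
  rw [map_sum]
  refine sum_mem fun ρ _ => ?_
  obtain ⟨x', hx', ex⟩ := hcomp hx π
  obtain ⟨y', hy', ey⟩ := hcomp hy ρ
  obtain ⟨E, hE⟩ := exists_isDefectGraph π ρ
  rw [ex, ey, F.mulSn_singlePull hE]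
  refine F.singlePull_mem_grSn ?_
  -- `2|E| = n + |⟨πρ⟩\[n]| - |⟨π⟩\[n]| - |⟨ρ⟩\[n]|` balances the degree shifts of the maps `φ^*`
  have hcount := hE.count_eq Set.univ fun x y _ => by simp
  have huniv : ∀ π : Perm (Fin n),
      classCount (permSetoid π) Set.univ = Nat.card (Orbits (Subgroup.zpowers π)) := fun π => by
    rw [classCount, Set.image_univ, Set.range_eq_univ.2 Quotient.mk_surjective, Set.ncard_univ]
  rw [edgeCount_univ, huniv, huniv, huniv, Set.ncard_univ, Nat.card_fin] at hcount
  have hcount' : (2 * E.length : ℤ) = n + Nat.card (Orbits (Subgroup.zpowers (π * ρ))) -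
      Nat.card (Orbits (Subgroup.zpowers π)) - Nat.card (Orbits (Subgroup.zpowers ρ)) := by
    omega
  convert F.pull_mem_tensorGr (Quotient.mk (permSetoid (π * ρ)))
    (F.edgeProd_mul_mem_tensorGr E (F.mul_mem_tensorGr hx' hy')) using 1
  rw [hcount', Nat.card_fin]
  ring_nf

end Product

end

end GradedFrobenius

theorem mainTheorem2 {A : Type*} [Ring A] [Algebra ℚ A] {d : ℕ} (F : GradedFrobenius A d)
    (n : ℕ) :
    -- the exponents of the Euler class are non-negative integers
    (∀ (π ρ : Equiv.Perm (Fin n)) (B : GradedFrobenius.Orbits (GradedFrobenius.pairGroup π ρ)),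
      ∃ m : ℕ, GradedFrobenius.graphDefect π ρ B = m) ∧
    -- associativity
    (∀ x y z : F.SnAlgebra n,
      F.mulSn n (F.mulSn n x y) z = F.mulSn n x (F.mulSn n y z)) ∧
    -- equivariance
    (∀ (σ : Equiv.Perm (Fin n)) (x y : F.SnAlgebra n),
      F.actSn σ (F.mulSn n x y) = F.mulSn n (F.actSn σ x) (F.actSn σ y)) ∧
    -- homogeneity of degree `n d`
    (∀ (p q : ℤ) (x y : F.SnAlgebra n), x ∈ F.grSn n p → y ∈ F.grSn n q →
      F.mulSn n x y ∈ F.grSn n (p + q + n * d)) := by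
  refine ⟨fun π ρ B => ?_, F.mulSn_assoc, F.actSn_mulSn, fun p q x y => F.mulSn_mem_grSn⟩
  obtain ⟨E, hE⟩ := GradedFrobenius.exists_isDefectGraph π ρ
  obtain ⟨b, hb, -⟩ := F.exists_graphDefect_eq hE
  exact ⟨b B, hb B⟩
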